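/- Two divisible items, one unit each, are to be allocated between two agents. A bid (or utility) vector over the two items is normalized if it has the form $(t,1-t)$ with $t\in[0,1]$, and the utilities are linear. A mechanism maps each pair of normalized bid vectors to amounts $A_{ij}$ of item $j$ given to agent $i$. It is feasible if $A_{ij}\ge 0$ and $A_{1j}+A_{2j}\le 1$ for all $i,j$ and all bids (so items may be allocated only partially). It is strategyproof if, for every bid of the other agent, bidding her true utility vector maximizes an agent's utility. It is $\alpha$-competitive if for all utility vectors $\vec u_1,\vec u_2$ its social welfare under truthful bids is at least $\alpha\sum_j\max\{u_{1j},u_{2j}\}$. It is symmetric if renaming the agents or the items in the bids renames the allocation in the same way. A function $A$ on $[0,1]^2$ describes the mechanism $A_{11}=A(b_1,b_2)$, $A_{12}=A(1-b_1,1-b_2)$, $A_{21}=A(b_2,b_1)$, $A_{22}=A(1-b_2,1-b_1)$, where $b_i$ is the first entry of agent $i$'s bid vector. Let $f_1(t)=t$ and $f_2(t)=\ln(2t)-t+\tfrac12$, let $N=1000$, $\delta=2.92/2000$ and $[N]=\{0,\tfrac1N,\dots,1\}$. For $Q,R:[N]\to\mathbb R$, $t_1\in[0,1]$ and $t_2\in[N]$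 put $$A_{Q,R}(t_1,t_2)=\begin{cases}Q(t_2)f_1(t_1)+R(t_2), & t_1\in[0,\tfrac12],\\ A_{Q,R}(\tfrac12,t_2)+Q(1-t_2)f_2(t_1), & t_1\in(\tfrac12,1],\end{cases}$$ and $\hat u_{Q,R}(t_1,t_2)=t_1A_{Q,R}(t_1,t_2)+(1-t_1)A_{Q,R}(1-t_1,1-t_2)$. Consider the linear program in the variables $Q(t),R(t)$ $(t\in[N])$ and $\lambda$: maximize $\lambda$ subject to, for all $t_1,t_2,t\in[N]$, $$A_{Q,R}(t_1,t_2)+A_{Q,R}(t_2,t_1)\le 1-\delta,\qquad \hat u_{Q,R}(t_1,t_2)+\hat u_{Q,R}(t_2,t_1)\ge(1+|t_1-t_2|)\lambda,\qquad Q(t),R(t)\ge 0.$$ Then the linear program has an optimal solution $(Q^*,R^*,\lambda^*)$ with $\lambda^*>0.835524$ and $Q^*(t)<1.46$ for all $t\in[N]$. For every optimal solution $(Q^*,R^*,\lambda^*)$ with $Q^*(t)<1.46$ for all $t\in[N]$, and for every rounding $t\mapsto\tilde t$ of $[0,1]$ to a nearest point of $[N]$ whose ties are broken so that $\widetilde{1-t}=1-\tilde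 t$ (such roundings exist), the mechanism described by $\tilde A(t_1,t_2)=A_{Q^*,R^*}(t_1,\tilde t_2)$ is symmetric, feasible, strategyproof and $0.833689$-competitive. Moreover, $0.833689>\tfrac56+10^{-9}$, so partial mechanisms strictly beat $\tfrac56$. -/

import Mathlib

/-!
Strategyproof allocation, without money, of `m` divisible items between two agents with
normalized linear utilities.
-/

namespace PartialMechanism

open Finset

noncomputable section

/-- A bid profile assigns to each of the two agents a bid vector over the `m` items. -/
abbrev Profile (m : ℕ) : Type := Fin 2 → Fin m → ℝ

/-- A mechanism maps a bid profile `b` to an allocation: `M b i j` is the amount of item `j`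
that agent `i` receives. Its values matter only on normalized profiles. -/
abbrev Mechanism (m : ℕ) : Type := Profile m → Fin 2 → Fin m → ℝ

/-- Every bid vector is normalized: its entries are nonnegative and sum to one. -/
def IsNormalized {m : ℕ} (b : Profile m) : Prop :=
  ∀ i, b i ∈ stdSimplex ℝ (Fin m)

/-- Amounts are nonnegative, and at most one unit of each item is handed out
(part of an item may be withheld). -/
def IsFeasible {m : ℕ} (M : Mechanism m) : Prop :=
  ∀ b, IsNormalized b → (∀ i j, 0 ≤ M b i j) ∧ ∀ j, M b 0 j + M b 1 j ≤ 1

/-- The utility of agent `i`, whose true utility vector is `u`, under the bids `b`. -/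
def utility {m : ℕ} (M : Mechanism m) (u : Fin m → ℝ) (b : Profile m) (i : Fin 2) : ℝ :=
  ∑ j, u j * M b i j

/-- Whatever the other agent bids, bidding the true utility vector is at least as good as
any other bid. -/
def IsStrategyproof {m : ℕ} (M : Mechanism m) : Prop :=
  ∀ (i : Fin 2) (u : Fin m → ℝ) (b : Profile m), u ∈ stdSimplex ℝ (Fin m) → IsNormalized b →
    utility M u b i ≤ utility M u (Function.update b i u) i

/-- The social welfare when both agents bid their true utility vectors. -/
def socialWelfare {m : ℕ} (M : Mechanism m) (u : Profile m) : ℝ :=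
  ∑ i, utility M (u i) u i

/-- The first-best social welfare. -/
def optWelfare {m : ℕ} (u : Profile m) : ℝ :=
  ∑ j, max (u 0 j) (u 1 j)

/-- The welfare guarantee of an `α`-competitive mechanism. -/
def IsCompetitive {m : ℕ} (α : ℝ) (M : Mechanism m) : Prop :=
  ∀ u, IsNormalized u → α * optWelfare u ≤ socialWelfare M u

/-- Symmetry over agents and over items: renaming the agents by `σ` and the items by `τ` in the
bids renames the allocation in the same way. -/
def IsSymmetric {m : ℕ} (M : Mechanism m) : Prop :=
  ∀ (σ : Equiv.Perm (Fin 2)) (τ : Equiv.Perm (Fin m)) (b : Profile m), IsNormalized b →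
    ∀ i j, M (fun i' j' => b (σ i') (τ j')) i j = M b (σ i) (τ j)

/-- The two-item mechanism described by a single function `A` on `[0,1]²`. A normalized bid
vector `(t, 1 - t)` is represented by its first entry `t`. -/
def ofFun (A : ℝ → ℝ → ℝ) : Mechanism 2 := fun b =>
  ![![A (b 0 0) (b 1 0), A (1 - b 0 0) (1 - b 1 0)],
    ![A (b 1 0) (b 0 0), A (1 - b 1 0) (1 - b 0 0)]]

/-- `f₁(t) = t`, used on `[0,1/2]`. -/
def f₁ (t : ℝ) : ℝ := t

/-- `f₂(t) = ln(2t) - t + 1/2`, used on `[1/2,1]`. -/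
def f₂ (t : ℝ) : ℝ := Real.log (2 * t) - t + 1 / 2

/-- The grid point `k/N`; note that `gridPt k.rev = 1 - gridPt k` for `N > 0`. -/
def gridPt {N : ℕ} (k : Fin (N + 1)) : ℝ := (k : ℝ) / (N : ℝ)

/-- The allocation function with coefficient vectors `Q`, `R` indexed by the grid, with a real
first argument `t` and a grid point `k/N` as second argument. -/
def alloc {N : ℕ} (Q R : Fin (N + 1) → ℝ) (t : ℝ) (k : Fin (N + 1)) : ℝ :=
  if t ≤ 1 / 2 then Q k * f₁ t + R k
  else (Q k * f₁ (1 / 2) + R k) + Q k.rev * f₂ t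

/-- The utility of a truthful agent with utility vector `(k/N, 1 - k/N)` against the bid `l/N`. -/
def gridUtility {N : ℕ} (Q R : Fin (N + 1) → ℝ) (k l : Fin (N + 1)) : ℝ :=
  gridPt k * alloc Q R (gridPt k) l + (1 - gridPt k) * alloc Q R (gridPt k.rev) l.rev

/-- The constraints of the linear program in the variables `Q`, `R`, `lam`. -/
structure LPFeasible (N : ℕ) (δ : ℝ) (Q R : Fin (N + 1) → ℝ) (lam : ℝ) : Prop where
  feasible : ∀ k l, alloc Q R (gridPt k) l + alloc Q R (gridPt l) k ≤ 1 - δ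
  competitive : ∀ k l,
    (1 + |gridPt k - gridPt l|) * lam ≤ gridUtility Q R k l + gridUtility Q R l k
  nonneg : ∀ k, 0 ≤ Q k ∧ 0 ≤ R k

/-- `(Q, R, lam)` is an optimal solution of the linear program: it maximizes `lam`. -/
def LPOptimal (N : ℕ) (δ : ℝ) (Q R : Fin (N + 1) → ℝ) (lam : ℝ) : Prop :=
  LPFeasible N δ Q R lam ∧ ∀ Q' R' lam', LPFeasible N δ Q' R' lam' → lam' ≤ lam

/-- `ρ` rounds each `t ∈ [0,1]` to a nearest grid point `ρ(t)/N`, and ties are broken so that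
the rounding respects the exchange `t ↦ 1 - t` of the two items. -/
structure IsRounding (N : ℕ) (ρ : ℝ → Fin (N + 1)) : Prop where
  nearest : ∀ t ∈ Set.Icc (0 : ℝ) 1, ∀ k : Fin (N + 1), |t - gridPt (ρ t)| ≤ |t - gridPt k|
  symm : ∀ t ∈ Set.Icc (0 : ℝ) 1, ρ (1 - t) = (ρ t).rev

/-- The mechanism with coefficients `Q`, `R`, in which the bid of the other agent is rounded
to the grid. -/
def roundedMechanism {N : ℕ} (Q R : Fin (N + 1) → ℝ) (ρ : ℝ → Fin (N + 1)) : Mechanism 2 :=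
  ofFun fun t₁ t₂ => alloc Q R t₁ (ρ t₂)

end

end PartialMechanism

/-!
A nearly optimal rational solution of the linear program is checked against all constraints but the
binding ones on packed integers. The binding constraints locate every optimal solution so precisely
that its binding entries can be combined with the rational solution elsewhere, which yields an
optimal solution with small slopes.
-/

namespace PartialMechanism

open Finset

noncomputable section

/-! ### The allocation function -/

/-! For nonnegative `Q` and `R` the allocation is automatically truthful. Against a fixed bid, an
agent of type `t` bidding `s ≤ 1/2` gets, up to a constant, a nonnegative multiple of `t * s + (1 -
t) * f₂ (1 - s)`. Since `f₂` has derivative `(1 - x) / x`, the derivative in `s` is `t - (1 - t) * s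
/ (1 - s)`, which changes sign at `s = t`. Bids above `1/2` follow by exchanging the items
(`truthful`).

Rounding only the other agent's bid keeps truthfulness. The allocation has slope at most `max Q` in
its first argument, so each of two competing amounts exceeds its grid value by at most `1.46 /
2000`; the reserve `δ` absorbs both. The welfare guarantee drops from `lam` to `lam - (lam + 1 - δ)
/ 1000`, because a truthful agent does no worse than by bidding the nearest grid point.

It remains to find an optimal solution of the linear program with large value and small slopes. An
explicit rational table is feasible (`lpFeasible_table`), and compactness gives an optimal solution
at least as good (`exists_lpOptimal`), whose slopes are not yet under control. Fourteen constraints,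
with four sign conditions, behave like a nondegenerate vertex: any solution as good as the table
agrees with it to `10⁻¹⁰` in the quantities that these constraints involve, and has value at most
`10⁻¹³` above it (`core_box`). All other constraints hold at the table with margin `3 * 10⁻⁸`,
checked by integer arithmetic. Hence the entries of the optimal solution at the binding grid points
can be grafted onto the table: the binding constraints persist, the others survive by their margin
(`lpFeasible_of_coreFeasible`), the value is unchanged, and the slopes are those of the table up to
`10⁻⁹`. -/

lemma f₂_half : f₂ (1 / 2) = 0 := by
  simp [f₂]

/-- From `log x ≥ 1 - 1 / x` at `x = t / s`: the logarithmic gain is at least `(t - s) / t`, which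
dominates `t - s` because `t ≤ 1`. -/
lemma f₂_sub_nonneg {s t : ℝ} (hs : 1 / 2 ≤ s) (hst : s ≤ t) (ht : t ≤ 1) : 0 ≤ f₂ t - f₂ s := by
  have hs0 : 0 < s := by linarith
  have ht0 : 0 < t := by linarith
  have h := Real.one_sub_inv_le_log_of_pos (div_pos ht0 hs0)
  rw [Real.log_div ht0.ne' hs0.ne', inv_div] at h
  have h2 : t - s ≤ 1 - s / t := by
    rw [← sub_nonneg]
    have : 1 - s / t - (t - s) = (t - s) * (1 - t) / t := by field_simp
    rw [this]
    exact div_nonneg (mul_nonneg (by linarith) (by linarith)) ht0.le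
  simp only [f₂]
  rw [Real.log_mul two_ne_zero ht0.ne', Real.log_mul two_ne_zero hs0.ne']
  linarith

/-- The derivative `1 / x - 1` is at most `1` from `1/2` onwards, so the logarithmic part of the
allocation is no steeper than the linear part. -/
lemma f₂_sub_le {s t : ℝ} (hs : 1 / 2 ≤ s) (hst : s ≤ t) : f₂ t - f₂ s ≤ t - s := by
  have hs0 : 0 < s := by linarith
  have ht0 : 0 < t := by linarith
  have h := Real.log_le_sub_one_of_pos (div_pos ht0 hs0)
  rw [Real.log_div ht0.ne' hs0.ne'] at h
  have h2 : t / s - 1 ≤ 2 * (t - s) := by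
    rw [div_sub_one hs0.ne', div_le_iff₀ hs0]
    nlinarith
  simp only [f₂]
  rw [Real.log_mul two_ne_zero ht0.ne', Real.log_mul two_ne_zero hs0.ne']
  linarith

variable {N : ℕ} {Q R : Fin (N + 1) → ℝ}

lemma alloc_of_le {t : ℝ} (ht : t ≤ 1 / 2) (k : Fin (N + 1)) : alloc Q R t k = Q k * t + R k := by
  simp only [alloc, ht, if_true, f₁]

lemma alloc_of_ge {t : ℝ} (ht : 1 / 2 ≤ t) (k : Fin (N + 1)) :
    alloc Q R t k = Q k / 2 + R k + Q k.rev * f₂ t := by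
  rcases ht.eq_or_lt with rfl | h
  · rw [alloc_of_le le_rfl, f₂_half]; ring
  · simp only [alloc, not_le.mpr h, if_false, f₁]; ring

/-- `alloc` is nondecreasing in its first argument, with slope at most any bound on `Q`. -/
lemma alloc_sub_mem {M : ℝ} (hQ : ∀ k, 0 ≤ Q k) (hM : ∀ k, Q k ≤ M) {s t : ℝ}
    (hst : s ≤ t) (ht : t ≤ 1) (k : Fin (N + 1)) :
    0 ≤ alloc Q R t k - alloc Q R s k ∧ alloc Q R t k - alloc Q R s k ≤ M * (t - s) := by
  have low : ∀ {s t : ℝ}, s ≤ t → t ≤ 1 / 2 → 0 ≤ alloc Q R t k - alloc Q R s k ∧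
      alloc Q R t k - alloc Q R s k ≤ M * (t - s) := by
    intro s t hst ht
    rw [alloc_of_le ht, alloc_of_le (hst.trans ht)]
    constructor <;> nlinarith [hQ k, hM k]
  have high : ∀ {s t : ℝ}, 1 / 2 ≤ s → s ≤ t → t ≤ 1 → 0 ≤ alloc Q R t k - alloc Q R s k ∧
      alloc Q R t k - alloc Q R s k ≤ M * (t - s) := by
    intro s t hs hst ht
    rw [alloc_of_ge hs, alloc_of_ge (hs.trans hst)]
    have h1 := f₂_sub_nonneg hs hst ht
    have h2 := f₂_sub_le hs hst
    have h3 := mul_nonneg (hQ k.rev) h1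
    have h4 : Q k.rev * (f₂ t - f₂ s) ≤ M * (t - s) :=
      mul_le_mul (hM _) h2 h1 ((hQ k).trans (hM k))
    constructor <;> nlinarith
  rcases le_total t (1 / 2) with h | h
  · exact low hst h
  · rcases le_total (1 / 2) s with h' | h'
    · exact high h' hst ht
    · obtain ⟨a, b⟩ := low h' le_rfl
      obtain ⟨a', b'⟩ := high le_rfl h ht
      constructor <;> nlinarith

lemma alloc_mono (hQ : ∀ k, 0 ≤ Q k) {s t : ℝ} (hst : s ≤ t) (ht : t ≤ 1) (k : Fin (N + 1)) :
    alloc Q R s k ≤ alloc Q R t k := by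
  have := (alloc_sub_mem (M := ∑ k, Q k) (R := R) hQ
    (fun k => Finset.single_le_sum (fun k _ => hQ k) (mem_univ k)) hst ht k).1
  linarith

lemma alloc_nonneg (hQ : ∀ k, 0 ≤ Q k) (hR : ∀ k, 0 ≤ R k) {t : ℝ} (h0 : 0 ≤ t) (h1 : t ≤ 1)
    (k : Fin (N + 1)) : 0 ≤ alloc Q R t k := by
  have := alloc_mono (R := R) hQ h0 h1 k
  rw [alloc_of_le (by norm_num : (0 : ℝ) ≤ 1 / 2)] at this
  linarith [hR k]

lemma abs_alloc_sub_le {M : ℝ} (hQ : ∀ k, 0 ≤ Q k) (hM : ∀ k, Q k ≤ M) {s t : ℝ}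
    (hs : s ≤ 1) (ht : t ≤ 1) (k : Fin (N + 1)) :
    |alloc Q R t k - alloc Q R s k| ≤ M * |t - s| := by
  rcases le_total s t with h | h
  · obtain ⟨a, b⟩ := alloc_sub_mem (R := R) hQ hM h ht k
    rwa [abs_of_nonneg a, abs_of_nonneg (sub_nonneg.2 h)]
  · obtain ⟨a, b⟩ := alloc_sub_mem (R := R) hQ hM h hs k
    rwa [abs_sub_comm, abs_of_nonneg a, abs_sub_comm, abs_of_nonneg (sub_nonneg.2 h)]

/-- The bid that an agent with true first entry `t` gains most from is `t`. -/
lemma f₂_truthful_same {s t : ℝ} (hs : s ≤ 1 / 2) (ht : t ≤ 1 / 2) :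
    t * s + (1 - t) * f₂ (1 - s) ≤ t * t + (1 - t) * f₂ (1 - t) := by
  have hs0 : 0 < 1 - s := by linarith
  have ht0 : 0 < 1 - t := by linarith
  have h := Real.one_sub_inv_le_log_of_pos (div_pos ht0 hs0)
  rw [Real.log_div ht0.ne' hs0.ne', inv_div] at h
  have h2 := mul_le_mul_of_nonneg_left h ht0.le
  have h3 : (1 - t) * (1 - (1 - s) / (1 - t)) = s - t := by field_simp; ring
  simp only [f₂]
  rw [Real.log_mul two_ne_zero ht0.ne', Real.log_mul two_ne_zero hs0.ne']
  rw [h3] at h2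
  nlinarith

/-- Moving the bid from `1/2` down to `s` costs `t * (1/2 - s)` on the first item and gains at most
`(1 - t) * (1/2 - s)` on the second, which is no more when `t ≥ 1/2`. -/
lemma f₂_truthful_cross {s t : ℝ} (hs : s ≤ 1 / 2) (ht : 1 / 2 ≤ t) (ht1 : t ≤ 1) :
    t * s + (1 - t) * f₂ (1 - s) ≤ t * (1 / 2) := by
  have h := Real.log_le_sub_one_of_pos (by linarith : 0 < 2 * (1 - s))
  have h2 : f₂ (1 - s) ≤ 1 / 2 - s := by simp only [f₂]; linarith
  nlinarith

/-- Truthful bidding is optimal against any fixed grid bid of the other agent. -/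
lemma truthful (hQ : ∀ k, 0 ≤ Q k) {s t : ℝ} (ht0 : 0 ≤ t) (ht1 : t ≤ 1) (l : Fin (N + 1)) :
    t * alloc Q R s l + (1 - t) * alloc Q R (1 - s) l.rev ≤
      t * alloc Q R t l + (1 - t) * alloc Q R (1 - t) l.rev := by
  -- Exchanging the items sends `t` to `1 - t` and `l` to `l.rev`, so `t ≤ 1/2` suffices.
  have key : ∀ {s t : ℝ} (l : Fin (N + 1)), 0 ≤ t → t ≤ 1 / 2 →
      t * alloc Q R s l + (1 - t) * alloc Q R (1 - s) l.rev ≤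
        t * alloc Q R t l + (1 - t) * alloc Q R (1 - t) l.rev := by
    intro s t l ht0 ht
    rw [alloc_of_le ht, alloc_of_ge (by linarith : 1 / 2 ≤ 1 - t), Fin.rev_rev]
    rcases le_total s (1 / 2) with hs | hs
    · rw [alloc_of_le hs, alloc_of_ge (by linarith : 1 / 2 ≤ 1 - s), Fin.rev_rev]
      have := mul_le_mul_of_nonneg_left (f₂_truthful_same hs ht) (hQ l)
      linarith
    -- A bid beyond `1/2` is compared with the truth through the bid `1/2`: the part weighted by `Q
    -- l` improves from `1/2` to `t`, the part weighted by `Q l.rev` from `s` to `1/2`.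
    · rw [alloc_of_ge hs, alloc_of_le (by linarith : 1 - s ≤ 1 / 2)]
      have h1 := mul_le_mul_of_nonneg_left (f₂_truthful_same le_rfl ht) (hQ l)
      rw [show (1 : ℝ) - 1 / 2 = 1 / 2 by norm_num, f₂_half] at h1
      have h2 := mul_le_mul_of_nonneg_left
        (f₂_truthful_cross (s := 1 - s) (t := 1 - t) (by linarith) (by linarith) (by linarith))
        (hQ l.rev)
      rw [sub_sub_cancel, sub_sub_cancel] at h2
      linarith
  rcases le_total t (1 / 2) with h | h
  · exact key l ht0 h
  · have := key (s := 1 - s) (t := 1 - t) l.rev (by linarith) (by linarith)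
    rw [sub_sub_cancel, sub_sub_cancel, Fin.rev_rev] at this
    linarith

/-! ### Rounding -/

lemma gridPt_rev (hN : 0 < N) (k : Fin (N + 1)) : gridPt k.rev = 1 - gridPt k := by
  have h : (N : ℝ) ≠ 0 := by positivity
  have hk : (k : ℕ) ≤ N := Nat.lt_succ_iff.mp k.2
  simp only [gridPt, Fin.val_rev]
  rw [show N + 1 - ((k : ℕ) + 1) = N - k by omega, Nat.cast_sub hk]
  field_simp

lemma gridPt_mem (k : Fin (N + 1)) : gridPt k ∈ Set.Icc (0 : ℝ) 1 := by
  have hk : (k : ℝ) ≤ N := by exact_mod_cast Nat.lt_succ_iff.mp k.2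
  exact ⟨by unfold gridPt; positivity, div_le_one_of_le₀ hk (by positivity)⟩

lemma exists_gridPt_near (hN : 0 < N) {t : ℝ} (ht : t ∈ Set.Icc (0 : ℝ) 1) :
    ∃ k : Fin (N + 1), |t - gridPt k| ≤ 1 / (2 * N) := by
  have hN' : (0 : ℝ) < N := by exact_mod_cast hN
  have h0 : 0 ≤ N * t + 1 / 2 := by have := mul_nonneg hN'.le ht.1; linarith
  have h1 := Nat.floor_le h0
  have h2 := Nat.lt_floor_add_one ((N : ℝ) * t + 1 / 2)
  have hlt : ⌊(N : ℝ) * t + 1 / 2⌋₊ < N + 1 := by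
    rw [Nat.floor_lt h0]
    push_cast
    nlinarith [ht.2]
  refine ⟨⟨_, hlt⟩, ?_⟩
  have : t - gridPt (N := N) ⟨_, hlt⟩ = (N * t - ⌊(N : ℝ) * t + 1 / 2⌋₊) / N := by
    simp only [gridPt]; field_simp
  rw [this, abs_div, abs_of_pos hN', div_le_div_iff₀ hN' (by positivity)]
  have : |(N : ℝ) * t - ⌊(N : ℝ) * t + 1 / 2⌋₊| ≤ 1 / 2 := abs_le.2 ⟨by linarith, by linarith⟩
  nlinarith

/-- Distinct grid points are at least `1 / N` apart, so a point within half that distance cannot be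
beaten. -/
lemma nearest_of_near (hN : 0 < N) {t : ℝ} {k : Fin (N + 1)} (hk : |t - gridPt k| ≤ 1 / (2 * N))
    (l : Fin (N + 1)) : |t - gridPt k| ≤ |t - gridPt l| := by
  have hN' : (0 : ℝ) < N := by exact_mod_cast hN
  by_cases h : k = l
  · rw [h]
  have h1 : (1 : ℝ) ≤ |(k : ℝ) - l| := by
    have : (1 : ℤ) ≤ |((k : ℕ) : ℤ) - ((l : ℕ) : ℤ)| := by
      refine Int.one_le_abs (sub_ne_zero.2 fun h' => h (Fin.ext ?_))
      exact_mod_cast h'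
    exact_mod_cast this
  have h2 : 1 / (N : ℝ) ≤ |gridPt k - gridPt l| := by
    rw [gridPt, gridPt, ← sub_div, abs_div, abs_of_pos hN']
    gcongr
  have h3 := abs_sub_le (gridPt k) t (gridPt l)
  rw [abs_sub_comm (gridPt k) t] at h3
  have h4 : 1 / (N : ℝ) = 1 / (2 * N) + 1 / (2 * N) := by field_simp; norm_num
  linarith

lemma IsRounding.abs_sub_le (hN : 0 < N) {ρ : ℝ → Fin (N + 1)} (h : IsRounding N ρ) {t : ℝ}
    (ht : t ∈ Set.Icc (0 : ℝ) 1) : |t - gridPt (ρ t)| ≤ 1 / (2 * N) := by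
  obtain ⟨k, hk⟩ := exists_gridPt_near hN ht
  exact (h.nearest t ht k).trans hk

/-- Round arbitrarily below `1/2` and reflect. The point `1/2` is its own mirror image, so its
rounding must be fixed by `Fin.rev`; this is where an even number of steps is needed. -/
lemma exists_isRounding (n : ℕ) (hn : 0 < n) : ∃ ρ : ℝ → Fin (2 * n + 1), IsRounding (2 * n) ρ := by
  have hN : 0 < 2 * n := by omega
  have : ∀ t : ℝ, ∃ k : Fin (2 * n + 1), t ∈ Set.Icc (0 : ℝ) 1 →
      |t - gridPt k| ≤ 1 / (2 * ((2 * n : ℕ) : ℝ)) := by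
    intro t
    by_cases ht : t ∈ Set.Icc (0 : ℝ) 1
    · obtain ⟨k, hk⟩ := exists_gridPt_near hN ht
      exact ⟨k, fun _ => hk⟩
    · exact ⟨0, fun h => absurd h ht⟩
  choose r hr using this
  let m : Fin (2 * n + 1) := ⟨n, by omega⟩
  have hm : m.rev = m := by ext; simp [m, Fin.val_rev]; omega
  have hmid : gridPt m = 1 / 2 := by
    have : (n : ℝ) ≠ 0 := by exact_mod_cast hn.ne'
    simp only [gridPt, m]; push_cast; field_simp
  refine ⟨fun t => if t < 1 / 2 then r t else if t = 1 / 2 then m else (r (1 - t)).rev,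
    fun t ht k => nearest_of_near hN ?_ k, fun t ht => ?_⟩
  · rcases lt_trichotomy t (1 / 2) with h | h | h
    · simpa only [h, if_true] using hr t ht
    · subst h
      simp only [lt_irrefl, if_false, if_true, hmid, sub_self, abs_zero]; positivity
    · have := hr (1 - t) ⟨by linarith [ht.2], by linarith [ht.1]⟩
      simp only [not_lt.2 h.le, h.ne', if_false, gridPt_rev hN]
      rwa [← abs_neg, show -(t - (1 - gridPt (r (1 - t)))) = 1 - t - gridPt (r (1 - t)) by ring]
  · rcases lt_trichotomy t (1 / 2) with h | h | h
    · simp only [h, if_true, not_lt.2 (by linarith : 1 / 2 ≤ 1 - t),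
        (by linarith : 1 / 2 < 1 - t).ne', if_false, sub_sub_cancel]
    · subst h
      simp only [lt_irrefl, if_false, if_true, hm, show (1 : ℝ) - 1 / 2 = 1 / 2 by norm_num]
    · simp only [not_lt.2 h.le, h.ne', if_false, (by linarith : 1 - t < 1 / 2), if_true,
        Fin.rev_rev]

/-! ### The rounded mechanism -/

lemma stdSimplex_two {u : Fin 2 → ℝ} (hu : u ∈ stdSimplex ℝ (Fin 2)) :
    u 0 ∈ Set.Icc (0 : ℝ) 1 ∧ u 1 = 1 - u 0 := by
  obtain ⟨h, hs⟩ := hu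
  rw [Fin.sum_univ_two] at hs
  exact ⟨⟨h 0, by linarith [h 1]⟩, by linarith⟩

lemma ofFun_isSymmetric (A : ℝ → ℝ → ℝ) : IsSymmetric (ofFun A) := by
  intro σ τ b hb i j
  have h0 := (stdSimplex_two (hb 0)).2
  have h1 := (stdSimplex_two (hb 1)).2
  have hσ : σ = 1 ∨ σ = Equiv.swap 0 1 := by revert σ; decide
  have hτ : τ = 1 ∨ τ = Equiv.swap 0 1 := by revert τ; decide
  rcases hσ with rfl | rfl <;> rcases hτ with rfl | rfl <;> fin_cases i <;> fin_cases j <;>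
    simp [ofFun, h0, h1]

variable {ρ : ℝ → Fin (N + 1)}

/-- The tie-breaking rule enters here: both items see the same rounded bid of the opponent, once
directly and once reflected. -/
lemma roundedMechanism_utility (hρ : IsRounding N ρ) (u : Fin 2 → ℝ) {b : Profile 2}
    (hb : IsNormalized b) (i : Fin 2) :
    utility (roundedMechanism Q R ρ) u b i =
      u 0 * alloc Q R (b i 0) (ρ (b i.rev 0)) +
        u 1 * alloc Q R (1 - b i 0) (ρ (b i.rev 0)).rev := by
  have h0 := hρ.symm _ (stdSimplex_two (hb 0)).1
  have h1 := hρ.symm _ (stdSimplex_two (hb 1)).1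
  fin_cases i <;> simp [utility, roundedMechanism, ofFun, Fin.sum_univ_two, h0, h1]

lemma roundedMechanism_isStrategyproof (hQ : ∀ k, 0 ≤ Q k) (hρ : IsRounding N ρ) :
    IsStrategyproof (roundedMechanism Q R ρ) := by
  intro i u b hu hb
  have hb' : IsNormalized (Function.update b i u) := by
    intro j
    by_cases h : j = i
    · subst h; simpa using hu
    · simpa [h] using hb j
  have hi : i.rev ≠ i := by fin_cases i <;> decide
  rw [roundedMechanism_utility hρ u hb, roundedMechanism_utility hρ u hb',
    Function.update_self, Function.update_of_ne hi, (stdSimplex_two hu).2]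
  exact truthful hQ (stdSimplex_two hu).1.1 (stdSimplex_two hu).1.2 _

/-- Each bid is within `1 / (2 * N)` of its grid point, so by the slope bound each of the two
amounts exceeds its grid value by at most `M / (2 * N)`. -/
lemma roundedMechanism_isFeasible (hN : 0 < N) {M δ lam : ℝ} (h : LPFeasible N δ Q R lam)
    (hM : ∀ k, Q k ≤ M) (hδ : M / N ≤ δ) (hρ : IsRounding N ρ) :
    IsFeasible (roundedMechanism Q R ρ) := by
  have hQ := fun k => (h.nonneg k).1
  have hR := fun k => (h.nonneg k).2
  have hN' : (0 : ℝ) < N := by exact_mod_cast hN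
  have hM0 : 0 ≤ M := (hQ 0).trans (hM 0)
  have key : ∀ {s t : ℝ}, s ∈ Set.Icc (0 : ℝ) 1 → t ∈ Set.Icc (0 : ℝ) 1 →
      alloc Q R s (ρ t) + alloc Q R t (ρ s) ≤ 1 := by
    intro s t hs ht
    have near : ∀ {s : ℝ} (k), s ∈ Set.Icc (0 : ℝ) 1 →
        alloc Q R s k ≤ alloc Q R (gridPt (ρ s)) k + M * (1 / (2 * N)) := by
      intro s k hs
      have h1 := (le_abs_self _).trans
        (abs_alloc_sub_le (R := R) hQ hM (gridPt_mem (ρ s)).2 hs.2 k)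
      have h2 := mul_le_mul_of_nonneg_left (hρ.abs_sub_le hN hs) hM0
      linarith
    have h1 := near (ρ t) hs
    have h2 := near (ρ s) ht
    have h3 := h.feasible (ρ s) (ρ t)
    have h4 : M * (1 / (2 * N)) + M * (1 / (2 * N)) = M / N := by field_simp; ring
    linarith
  intro b hb
  have h0 := (stdSimplex_two (hb 0)).1
  have h1 := (stdSimplex_two (hb 1)).1
  have hc : ∀ {t : ℝ}, t ∈ Set.Icc (0 : ℝ) 1 → 1 - t ∈ Set.Icc (0 : ℝ) 1 :=
    fun h => ⟨by linarith [h.2], by linarith [h.1]⟩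
  have nn : ∀ {t : ℝ} (k), t ∈ Set.Icc (0 : ℝ) 1 → 0 ≤ alloc Q R t k :=
    fun k h => alloc_nonneg hQ hR h.1 h.2 k
  constructor
  · intro i j
    fin_cases i <;> fin_cases j <;> simp [roundedMechanism, ofFun] <;>
      apply nn <;> first | exact h0 | exact h1 | exact hc h0 | exact hc h1
  · intro j
    fin_cases j <;> simp [roundedMechanism, ofFun] <;> apply key <;>
      first | exact h0 | exact h1 | exact hc h0 | exact hc h1

/-- With `d` the true distance of the types, the grid constraint and the losses of both agents give
welfare at least `lam * (1 + d - 1 / N) - (1 - δ) / N`. Comparison with `α * (1 + d)` needs `hα` for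
the constant term and `hαl` for the coefficient of `d`. -/
lemma roundedMechanism_isCompetitive (hN : 0 < N) {α δ lam : ℝ} (h : LPFeasible N δ Q R lam)
    (hρ : IsRounding N ρ) (hα0 : 0 ≤ α) (hαl : α ≤ lam)
    (hα : α ≤ lam - (lam + (1 - δ)) / N) :
    IsCompetitive α (roundedMechanism Q R ρ) := by
  have hQ := fun k => (h.nonneg k).1
  have hR := fun k => (h.nonneg k).2
  have hN' : (0 : ℝ) < N := by exact_mod_cast hN
  -- By monotonicity the worst bid is `1`, which is a grid point; the opponent's share in that
  -- feasibility constraint is dropped.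
  have upper : ∀ {t : ℝ} (k), t ∈ Set.Icc (0 : ℝ) 1 → alloc Q R t k ≤ 1 - δ := by
    intro t k ht
    have h1 := alloc_mono (R := R) hQ ht.2 le_rfl k
    have h2 := h.feasible (Fin.last N) k
    have h3 : gridPt (Fin.last N) = 1 := by simp [gridPt, hN'.ne']
    have h4 := alloc_nonneg hQ hR (gridPt_mem k).1 (gridPt_mem k).2 (Fin.last N)
    rw [h3] at h2
    linarith
  have hδ : 0 ≤ 1 - δ := (alloc_nonneg hQ hR le_rfl zero_le_one 0).trans
    (upper 0 ⟨le_rfl, zero_le_one⟩)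
  -- Truth is at least as good as bidding the nearest grid point. For that fixed bid, replacing the
  -- true weights by grid weights changes the utility by the rounding error times a difference of
  -- two amounts in `[0, 1 - δ]`.
  have loss : ∀ {t : ℝ} (l), t ∈ Set.Icc (0 : ℝ) 1 →
      gridUtility Q R (ρ t) l - (1 - δ) * (1 / (2 * N)) ≤
        t * alloc Q R t l + (1 - t) * alloc Q R (1 - t) l.rev := by
    intro t l ht
    have h1 := truthful (R := R) (s := gridPt (ρ t)) hQ ht.1 ht.2 l
    have hs := gridPt_mem (ρ t)
    have hs' := gridPt_mem (ρ t).rev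
    have hab : |alloc Q R (gridPt (ρ t)) l - alloc Q R (gridPt (ρ t).rev) l.rev| ≤ 1 - δ := by
      have a1 := upper l hs
      have a2 := upper l.rev hs'
      have a3 := alloc_nonneg hQ hR hs.1 hs.2 l
      have a4 := alloc_nonneg hQ hR hs'.1 hs'.2 l.rev
      exact abs_le.2 ⟨by linarith, by linarith⟩
    have h2 : |(t - gridPt (ρ t)) *
        (alloc Q R (gridPt (ρ t)) l - alloc Q R (gridPt (ρ t).rev) l.rev)| ≤
        1 / (2 * N) * (1 - δ) := by
      rw [abs_mul]
      exact mul_le_mul (hρ.abs_sub_le hN ht) hab (abs_nonneg _) (by positivity)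
    have h3 := neg_le_of_abs_le h2
    rw [gridUtility]
    rw [← gridPt_rev hN] at h1
    linarith
  intro u hu
  obtain ⟨h0, h0'⟩ := stdSimplex_two (hu 0)
  obtain ⟨h1, h1'⟩ := stdSimplex_two (hu 1)
  have hopt : optWelfare u = 1 + |u 0 0 - u 1 0| := by
    rw [optWelfare, Fin.sum_univ_two, h0', h1']
    rcases le_total (u 0 0) (u 1 0) with h | h
    · rw [max_eq_right h, max_eq_left (by linarith), abs_of_nonpos (by linarith)]; ring
    · rw [max_eq_left h, max_eq_right (by linarith), abs_of_nonneg (by linarith)]; ring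
  rw [hopt, socialWelfare, Fin.sum_univ_two, roundedMechanism_utility hρ _ hu,
    roundedMechanism_utility hρ _ hu, h0', h1']
  have l0 := loss (ρ (u 1 0)) h0
  have l1 := loss (ρ (u 0 0)) h1
  have hc := h.competitive (ρ (u 0 0)) (ρ (u 1 0))
  have hd : |u 0 0 - u 1 0| ≤ |gridPt (ρ (u 0 0)) - gridPt (ρ (u 1 0))| + 1 / N := by
    have e0 := hρ.abs_sub_le hN h0
    have e1 := hρ.abs_sub_le hN h1
    have e2 : 1 / (N : ℝ) = 1 / (2 * N) + 1 / (2 * N) := by field_simp; norm_num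
    have e3 := abs_add_three (u 0 0 - gridPt (ρ (u 0 0)))
      (gridPt (ρ (u 0 0)) - gridPt (ρ (u 1 0))) (gridPt (ρ (u 1 0)) - u 1 0)
    rw [abs_sub_comm (gridPt (ρ (u 1 0)))] at e3
    rw [show u 0 0 - gridPt (ρ (u 0 0)) + (gridPt (ρ (u 0 0)) - gridPt (ρ (u 1 0))) +
      (gridPt (ρ (u 1 0)) - u 1 0) = u 0 0 - u 1 0 by ring] at e3
    linarith
  set d := |u 0 0 - u 1 0|
  set d' := |gridPt (ρ (u 0 0)) - gridPt (ρ (u 1 0))|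
  have hd0 : 0 ≤ d := abs_nonneg _
  have e5 : (1 - δ) * (1 / (2 * N)) + (1 - δ) * (1 / (2 * N)) = (1 - δ) / N := by field_simp; ring
  have e6 : (1 + (d - 1 / N)) * lam ≤ (1 + d') * lam :=
    mul_le_mul_of_nonneg_right (by linarith) (hα0.trans hαl)
  have e7 : α * d ≤ lam * d := mul_le_mul_of_nonneg_right hαl hd0
  have e8 : (lam + (1 - δ)) / N = lam * (1 / N) + (1 - δ) / N := by ring
  have r0 : (0 : Fin 2).rev = 1 := rfl
  have r1 : (1 : Fin 2).rev = 0 := rfl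
  rw [r0, r1]
  nlinarith

end

/-! ### Checking many linear inequalities at once on packed natural numbers -/

/-- The numbers `f 0, …, f (n - 1)`, stored in consecutive lanes of 160 bits. -/
def pack (f : ℕ → ℕ) : ℕ → ℕ
  | 0 => 0
  | n + 1 => 2 ^ (160 * n) * f n + pack f n

lemma pack_lt {f : ℕ → ℕ} {n : ℕ} (h : ∀ j < n, f j < 2 ^ 160) : pack f n < 2 ^ (160 * n) := by
  induction n with
  | zero => simp [pack]
  | succ n ih =>
    have h1 := ih fun j hj => h j (by omega)
    have h2 : f n + 1 ≤ 2 ^ 160 := h n (by omega)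
    calc pack f (n + 1) < 2 ^ (160 * n) * f n + 2 ^ (160 * n) := by rw [pack]; omega
      _ = 2 ^ (160 * n) * (f n + 1) := by ring
      _ ≤ 2 ^ (160 * n) * 2 ^ 160 := Nat.mul_le_mul_left _ h2
      _ = 2 ^ (160 * (n + 1)) := by rw [← pow_add]; ring_nf

/-- Entries below `2 ^ 160` do not carry into the next lane, so bit 159 of each entry can be read
off the packed number. -/
lemma testBit_pack {f : ℕ → ℕ} {n : ℕ} (h : ∀ j < n, f j < 2 ^ 160) {j : ℕ} (hj : j < n) :
    (pack f n).testBit (160 * j + 159) = (f j).testBit 159 := by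
  induction n with
  | zero => omega
  | succ n ih =>
    have h1 := pack_lt fun j hj => h j (Nat.lt_succ_of_lt hj)
    rw [pack, Nat.testBit_two_pow_mul_add _ h1]
    rcases Nat.lt_succ_iff_lt_or_eq.mp hj with hj' | rfl
    · rw [if_pos (by omega)]
      exact ih (fun j hj => h j (by omega)) hj'
    · rw [if_neg (by omega)]
      congr 1; omega

lemma pack_add (f g : ℕ → ℕ) (n : ℕ) : pack (fun j => f j + g j) n = pack f n + pack g n := by
  induction n with
  | zero => rfl
  | succ n ih => simp only [pack, ih]; ring

lemma pack_mul (c : ℕ) (f : ℕ → ℕ) (n : ℕ) : pack (fun j => c * f j) n = c * pack f n := by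
  induction n with
  | zero => rfl
  | succ n ih => simp only [pack, ih]; ring

lemma pack_const (c n : ℕ) : pack (fun _ => c) n = c * pack (fun _ => 1) n := by
  simpa using pack_mul c (fun _ => 1) n

lemma pack_single (a n : ℕ) (ha : a < n) :
    pack (fun j => if j = a then 1 else 0) n = 2 ^ (160 * a) := by
  have zero : ∀ m ≤ a, pack (fun j => if j = a then 1 else 0) m = 0 := by
    intro m hm
    induction m with
    | zero => rfl
    | succ m ih => rw [pack, ih (by omega), if_neg (by omega)]; simp
  induction n with
  | zero => omega
  | succ n ih =>
    rw [pack]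
    rcases Nat.lt_succ_iff_lt_or_eq.mp ha with h | rfl
    · rw [ih h, if_neg (by omega)]; simp
    · rw [zero _ le_rfl]; simp

/-- The sign lanes of a packed vector. -/
lemma lane_ge {f : ℕ → ℕ} {n : ℕ} (h : ∀ j < n, f j < 2 ^ 160)
    (hm : pack f n &&& pack (fun _ => 2 ^ 159) n = pack (fun _ => 2 ^ 159) n) {j : ℕ}
    (hj : j < n) : 2 ^ 159 ≤ f j := by
  have h1 := congrArg (fun x => x.testBit (160 * j + 159)) hm
  simp only [Nat.testBit_and] at h1
  rw [testBit_pack h hj, testBit_pack (f := fun _ => 2 ^ 159) (fun _ _ => by norm_num) hj,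
    Nat.testBit_two_pow_self, Bool.and_true] at h1
  exact Nat.ge_two_pow_of_testBit h1

/-! ### A nearly optimal solution of the linear program

All coefficients are stored as natural numbers in units of `10⁻¹⁸`. -/

/-- Linear interpolation between `(a, x)` and `(b, y)`, from units of `10⁻¹⁰` to `10⁻¹⁸`. -/
def lerp (a x b y k : ℕ) : ℕ := 10 ^ 8 * (x * (b - k) + y * (k - a)) / (b - a)

/-- Piecewise linear interpolation of two functions given at the knots of a list. -/
def interp : ℕ → ℕ → ℕ → List (ℕ × ℕ × ℕ) → ℕ → ℕ × ℕ
  | _, x, y, [], _ => (x, y)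
  | a, x, y, (b, x', y') :: l, k =>
    bif Nat.ble b k then interp b x' y' l k else (lerp a x b x' k, lerp a y b y' k)

/-- The knots `(k, Q, R)` of the piecewise linear part of the solution, in units of `10⁻¹⁰`. -/
def knots : List (ℕ × ℕ × ℕ) :=
  [(0, 7599916507, 4993213754), (120, 8054867235, 4019099312), (160, 10498664151, 2644630932),
   (240, 14310061971, 379870312), (280, 14383409281, 90027), (300, 14145332416, 0),
   (360, 12980239022, 0), (367, 12450120022, 163358043), (369, 12388304495, 184748005),
   (501, 9689827460, 149), (560, 8652114456, 56859), (600, 7727050981, 133658636),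
   (620, 7162472882, 244030828), (631, 6877722109, 293975900), (633, 6870370853, 276851144),
   (640, 6477945127, 339819962), (660, 6099987455, 364325225), (687, 5622007567, 365469744),
   (700, 5423560064, 349888883), (720, 5323719821, 249026618), (760, 4974239853, 212535880),
   (780, 5179406270, 174294373), (800, 5364541755, 142651483), (808, 5434795526, 130839783),
   (840, 5714001805, 84046185), (860, 5953031853, 63948269), (880, 6202655981, 36312599),
   (920, 6142724435, 96349), (980, 6160210266, 32296), (1000, 6173555712, 1224)]

/-- The entries `(k, Q, R)` at the grid points that occur in the binding constraints. -/
def coreTable : List (ℕ × ℕ × ℕ) :=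
  [(0, 760054348654619022, 499269999999995000), (193, 1207097259230785313, 171037939463403179),
   (311, 1393173257789632013, 0), (312, 1391231435467412244, 0),
   (368, 1242395987900000000, 17925480000000000), (500, 970911161109884224, 0),
   (632, 684556633400000000, 29873220313446671), (688, 561014280400000000, 36258159174455131),
   (689, 559381331200000000, 36191518507556262), (807, 542599014206100533, 13231183663305795),
   (1000, 617367674366218318, 0)]

/-- The nearly optimal coefficients at the grid point `k / 1000`. -/
def table (k : ℕ) : ℕ × ℕ := (coreTable.lookup k).getD (interp 0 0 0 knots k)

def qTab (k : ℕ) : ℕ := (table k).1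

def rTab (k : ℕ) : ℕ := (table k).2

/-- The value attained by the table. -/
def lamTab : ℕ := 835524290631156855

/-- A lower approximation of `10¹⁸ log ((m + 1) / m)`. -/
def logStep (m : ℕ) : ℕ :=
  2 * 10 ^ 18 * (15 * (2 * m + 1) ^ 4 + 5 * (2 * m + 1) ^ 2 + 3) / (15 * (2 * m + 1) ^ 5)

/-- A lower approximation of `10¹⁸ log ((500 + n) / 500)`. -/
def logTab : ℕ → ℕ
  | 0 => 0
  | n + 1 => logTab n + logStep (500 + n)

/-- A lower approximation of `10¹⁸ f₂ (1 - j / 1000)`. -/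
def gTab (j : ℕ) : ℕ := logTab (500 - j) - (500 - j) * 10 ^ 15

/-- `10³⁶ (Q / 2 + R)` at `k / 1000`. -/
def hTab (k : ℕ) : ℕ := 5 * 10 ^ 17 * qTab k + 10 ^ 18 * rTab k

/-- A lower approximation of `10²¹ (t² + (1 - t) f₂ (1 - t))` at `t = j / 1000`. -/
def phiTab (j : ℕ) : ℕ := 10 ^ 15 * (j * j) + (1000 - j) * gTab j

lemma table_bounds : ∀ k < 1001, qTab k ≤ 144 * 10 ^ 16 ∧ rTab k ≤ 10 ^ 18 := by
  decide +kernel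

/-- The lower bound makes the truncated subtraction in `gTab` exact; the upper bound controls lane
sizes. -/
lemma logTab_bounds : ∀ n < 501, n * 10 ^ 15 ≤ logTab n ∧ logTab n ≤ n * 10 ^ 15 + 2 * 10 ^ 17 := by
  decide +kernel

/-- The packed relief granted to the exceptional lanes `j`, `(i, j) ∈ e`, of row `i`. -/
def relief (e : List (ℕ × ℕ)) (i : ℕ) : ℕ :=
  (e.map fun p => if p.1 = i then 2 ^ (160 * p.2) else 0).sum

lemma pack_count (i n : ℕ) (e : List (ℕ × ℕ)) (he : ∀ p ∈ e, p.2 < n) :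
    pack (fun j => e.count (i, j)) n = relief e i := by
  induction e with
  | nil => simpa [relief] using pack_const 0 n
  | cons p e ih =>
    have h1 := ih fun p hp => he p (List.mem_cons_of_mem _ hp)
    have h2 := he p List.mem_cons_self
    have h3 : (fun j => (p :: e).count (i, j)) =
        fun j => e.count (i, j) + (if p.1 = i then 1 else 0) * if j = p.2 then 1 else 0 := by
      funext j
      obtain ⟨a, b⟩ := p
      rw [List.count_cons]
      by_cases ha : a = i <;> by_cases hb : b = j <;> simp [ha, hb, @eq_comm _ j b]
    rw [h3, pack_add, pack_mul, h1, pack_single _ _ h2]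
    simp only [relief, List.map_cons, List.sum_cons]
    split_ifs <;> ring

/-- Compares two packed vectors of length 501, except in the lanes of row `i` listed in `e`. -/
def lanesLE (e : List (ℕ × ℕ)) (i v w : ℕ) : Bool :=
  Nat.beq (w + pack (fun _ => 2 ^ 159) 501 + 2 ^ 158 * relief e i - v &&&
    pack (fun _ => 2 ^ 159) 501) (pack (fun _ => 2 ^ 159) 501)

/-- Lane `j` of the difference is `w j + 2 ^ 159 - v j`, whose top bit is set exactly when `v j ≤ w
j`. An exceptional lane gets an extra `2 ^ 158`, which exceeds `v j`, so it always passes. As `w j <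
2 ^ 158` and exceptions are not repeated, every lane stays below `2 ^ 160`, and no borrowing occurs.
-/
lemma le_of_lanesLE {e : List (ℕ × ℕ)} {i : ℕ} {v w : ℕ → ℕ} (he : ∀ p ∈ e, p.2 < 501)
    (hn : e.Nodup) (hv : ∀ j < 501, v j < 2 ^ 158) (hw : ∀ j < 501, w j < 2 ^ 158)
    (h : lanesLE e i (pack v 501) (pack w 501) = true) {j : ℕ} (hj : j < 501) (hij : (i, j) ∉ e) :
    v j ≤ w j := by
  have hc : ∀ j, e.count (i, j) ≤ 1 := fun j => List.nodup_iff_count_le_one.mp hn _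
  let u : ℕ → ℕ := fun j => w j + 2 ^ 159 + 2 ^ 158 * e.count (i, j) - v j
  have hsum : ∀ n ≤ 501, pack (fun j => w j + 2 ^ 159 + 2 ^ 158 * e.count (i, j)) n =
      pack u n + pack v n := by
    intro n hn
    induction n with
    | zero => rfl
    | succ n ih =>
      have h1 : w n + 2 ^ 159 + 2 ^ 158 * e.count (i, n) = u n + v n := by
        have := hv n (by omega)
        simp only [u]; omega
      rw [pack, h1, ih (by omega), pack, pack]; ring
  have hu : pack w 501 + pack (fun _ => 2 ^ 159) 501 + 2 ^ 158 * relief e i - pack v 501 =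
      pack u 501 := by
    rw [← pack_count i 501 e he, ← pack_mul, ← pack_add, ← pack_add]
    exact Nat.sub_eq_of_eq_add (hsum 501 le_rfl)
  rw [lanesLE, hu] at h
  have h1 := lane_ge (f := u) (fun j hj => ?_) (Nat.eq_of_beq_eq_true h) hj
  · simp only [u, List.count_eq_zero_of_not_mem hij] at h1
    have := hv j hj
    omega
  · have h1 := hc j
    have h2 := hw j hj
    simp only [u]
    omega

/-! ### The five families of constraints

A grid point is `i / 1000` or `1 - i / 1000` with `i ≤ 500`, and is called low or high accordingly.
-/

/-- The binding pairs in the feasibility constraints of two low points. -/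
def excLL : List (ℕ × ℕ) := [(0, 0), (311, 500), (500, 311), (312, 500), (500, 312)]

/-- The binding pairs in the feasibility constraints of a low and a high point. -/
def excLH : List (ℕ × ℕ) := [(0, 193), (0, 0), (193, 0), (311, 500), (312, 500)]

/-- The binding pairs in the feasibility constraints of two high points. -/
def excHH : List (ℕ × ℕ) := [(311, 311), (193, 312), (312, 193), (0, 368), (368, 0)]

/-- The binding pairs in the welfare constraints of two low points. -/
def excWLL : List (ℕ × ℕ) :=
  [(193, 0), (0, 193), (311, 0), (0, 311), (312, 0), (0, 312), (368, 0), (0, 368),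
    (500, 193), (193, 500)]

/-- The binding pairs in the welfare constraints of a low and a high point. -/
def excWLH : List (ℕ × ℕ) := [(193, 500), (500, 193)]

/-- Row `i` of each family is a combination of these vectors with coefficients depending on `i`, so
501 comparisons are made by a few operations on long integers. -/
def pOne : ℕ := pack (fun _ => 1) 501
def pIdx : ℕ := pack (fun j => j) 501
def pCoidx : ℕ := pack (fun j => 1000 - j) 501
def pQ : ℕ := pack qTab 501
def pR : ℕ := pack rTab 501
def pQ' : ℕ := pack (fun j => qTab (1000 - j)) 501
def pR' : ℕ := pack (fun j => rTab (1000 - j)) 501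
def pG : ℕ := pack gTab 501
def pPhi : ℕ := pack phiTab 501
def pH : ℕ := pack hTab 501
def pH' : ℕ := pack (fun j => hTab (1000 - j)) 501

/-- The unit is `10⁻²¹`: the right side is `1 - δ` and `3 * 10 ^ 13` is the margin `3 * 10⁻⁸`. The
rows below keep this margin in units of `10⁻³⁶` (feasibility) and `10⁻³⁹` (welfare). -/
def rowLL (i : ℕ) : Bool :=
  lanesLE excLL i (qTab i * pIdx + i * pQ + 1000 * pR + (1000 * rTab i + 3 * 10 ^ 13) * pOne)
    (99854 * 10 ^ 16 * pOne)

def rowLH (i : ℕ) : Bool :=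
  lanesLE excLH i (qTab (1000 - i) * pG + 10 ^ 15 * i * pQ' + 10 ^ 18 * pR' +
    (hTab i + 3 * 10 ^ 28) * pOne) (99854 * 10 ^ 31 * pOne)

def rowHH (i : ℕ) : Bool :=
  lanesLE excHH i (qTab i * pG + gTab i * pQ + 1 * pH' + (hTab (1000 - i) + 3 * 10 ^ 28) * pOne)
    (99854 * 10 ^ 31 * pOne)

def rowWLL (i : ℕ) : Bool :=
  lanesLE excWLL i (((lamTab + 10 ^ 5) * 10 ^ 18 * (1000 + i) + 3 * 10 ^ 31) * pOne)
    (phiTab i * pQ + 10 ^ 18 * i * pR + (1000 - i) * pH' + qTab i * pPhi +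
      (10 ^ 18 * rTab i + (lamTab + 10 ^ 5) * 10 ^ 18) * pIdx + hTab (1000 - i) * pCoidx)

def rowWLH (i : ℕ) : Bool :=
  lanesLE excWLH i (((lamTab + 10 ^ 5) * 10 ^ 18 * (2000 - i) + 3 * 10 ^ 31) * pOne)
    (phiTab i * pQ' + 10 ^ 18 * i * pR' + (1000 - i) * pH + qTab (1000 - i) * pPhi +
      (10 ^ 18 * rTab (1000 - i) + (lamTab + 10 ^ 5) * 10 ^ 18) * pIdx + hTab i * pCoidx)

lemma rowLL_check : ∀ i < 501, rowLL i = true := by decide +kernel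

lemma rowLH_check : ∀ i < 501, rowLH i = true := by decide +kernel

lemma rowHH_check : ∀ i < 501, rowHH i = true := by decide +kernel

lemma rowWLL_check : ∀ i < 501, rowWLL i = true := by decide +kernel

lemma rowWLH_check : ∀ i < 501, rowWLH i = true := by decide +kernel

lemma gTab_le {j : ℕ} : gTab j ≤ 2 * 10 ^ 17 := by
  have := (logTab_bounds (500 - j) (by omega)).2
  rw [gTab]; omega

lemma qTab_le {k : ℕ} (hk : k < 1001) : qTab k ≤ 144 * 10 ^ 16 := (table_bounds k hk).1

lemma rTab_le {k : ℕ} (hk : k < 1001) : rTab k ≤ 10 ^ 18 := (table_bounds k hk).2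

lemma hTab_le {k : ℕ} (hk : k < 1001) : hTab k ≤ 2 * 10 ^ 36 := by
  have h1 := qTab_le hk
  have h2 := rTab_le hk
  rw [hTab]; omega

lemma phiTab_le {j : ℕ} (hj : j < 501) : phiTab j ≤ 10 ^ 21 := by
  have h1 : j * j ≤ 500 * 500 := Nat.mul_self_le_mul_self (by omega)
  have h2 : (1000 - j) * gTab j ≤ 1000 * (2 * 10 ^ 17) := Nat.mul_le_mul (by omega) gTab_le
  rw [phiTab]; omega

lemma tab_LL {i j : ℕ} (hi : i < 501) (hj : j < 501) (h : (i, j) ∉ excLL) :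
    qTab i * j + i * qTab j + 1000 * rTab j + (1000 * rTab i + 3 * 10 ^ 13) ≤ 99854 * 10 ^ 16 := by
  refine le_of_lanesLE (i := i) (j := j) (e := excLL)
    (v := fun j => qTab i * j + i * qTab j + 1000 * rTab j + (1000 * rTab i + 3 * 10 ^ 13))
    (w := fun _ => 99854 * 10 ^ 16) (by decide) (by decide) (fun j hj => ?_)
    (fun _ _ => by norm_num) ?_ hj h
  · calc _ ≤ 144 * 10 ^ 16 * 501 + 501 * (144 * 10 ^ 16) + 1000 * 10 ^ 18 +
          (1000 * 10 ^ 18 + 3 * 10 ^ 13) := by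
          have := qTab_le (show i < 1001 by omega)
          have := qTab_le (show j < 1001 by omega)
          have := rTab_le (show i < 1001 by omega)
          have := rTab_le (show j < 1001 by omega)
          gcongr
      _ < 2 ^ 158 := by norm_num
  -- Linearity of `pack` turns the packed row into the combination of packed vectors that was
  -- evaluated.
  · rw [pack_const (99854 * 10 ^ 16), pack_add, pack_add, pack_add,
      pack_const (1000 * rTab i + 3 * 10 ^ 13), pack_mul, pack_mul, pack_mul]
    have h := rowLL_check i hi
    simp only [rowLL, pOne, pIdx, pQ, pR] at h
    exact h

lemma tab_LH {i j : ℕ} (hi : i < 501) (hj : j < 501) (h : (i, j) ∉ excLH) :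
    qTab (1000 - i) * gTab j + 10 ^ 15 * i * qTab (1000 - j) + 10 ^ 18 * rTab (1000 - j) +
      (hTab i + 3 * 10 ^ 28) ≤ 99854 * 10 ^ 31 := by
  refine le_of_lanesLE (i := i) (j := j) (e := excLH)
    (v := fun j => qTab (1000 - i) * gTab j + 10 ^ 15 * i * qTab (1000 - j) +
      10 ^ 18 * rTab (1000 - j) + (hTab i + 3 * 10 ^ 28))
    (w := fun _ => 99854 * 10 ^ 31) (by decide) (by decide) (fun j hj => ?_)
    (fun _ _ => by norm_num) ?_ hj h
  · calc _ ≤ 144 * 10 ^ 16 * (2 * 10 ^ 17) + 10 ^ 15 * 501 * (144 * 10 ^ 16) + 10 ^ 18 * 10 ^ 18 +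
          (2 * 10 ^ 36 + 3 * 10 ^ 28) := by
          have := qTab_le (show 1000 - i < 1001 by omega)
          have := qTab_le (show 1000 - j < 1001 by omega)
          have := rTab_le (show 1000 - j < 1001 by omega)
          have := hTab_le (show i < 1001 by omega)
          have := gTab_le (j := j)
          gcongr
      _ < 2 ^ 158 := by norm_num
  · rw [pack_const (99854 * 10 ^ 31), pack_add, pack_add, pack_add,
      pack_const (hTab i + 3 * 10 ^ 28), pack_mul, pack_mul, pack_mul]
    have h := rowLH_check i hi
    simp only [rowLH, pOne, pG, pQ', pR'] at h
    exact h

lemma tab_HH {i j : ℕ} (hi : i < 501) (hj : j < 501) (h : (i, j) ∉ excHH) :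
    qTab i * gTab j + gTab i * qTab j + 1 * hTab (1000 - j) + (hTab (1000 - i) + 3 * 10 ^ 28) ≤
      99854 * 10 ^ 31 := by
  refine le_of_lanesLE (i := i) (j := j) (e := excHH)
    (v := fun j => qTab i * gTab j + gTab i * qTab j + 1 * hTab (1000 - j) +
      (hTab (1000 - i) + 3 * 10 ^ 28))
    (w := fun _ => 99854 * 10 ^ 31) (by decide) (by decide) (fun j hj => ?_)
    (fun _ _ => by norm_num) ?_ hj h
  · calc _ ≤ 144 * 10 ^ 16 * (2 * 10 ^ 17) + 2 * 10 ^ 17 * (144 * 10 ^ 16) + 1 * (2 * 10 ^ 36) +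
          (2 * 10 ^ 36 + 3 * 10 ^ 28) := by
          have := qTab_le (show i < 1001 by omega)
          have := qTab_le (show j < 1001 by omega)
          have := hTab_le (show 1000 - i < 1001 by omega)
          have := hTab_le (show 1000 - j < 1001 by omega)
          have := gTab_le (j := i)
          have := gTab_le (j := j)
          gcongr
      _ < 2 ^ 158 := by norm_num
  · rw [pack_const (99854 * 10 ^ 31), pack_add, pack_add, pack_add,
      pack_const (hTab (1000 - i) + 3 * 10 ^ 28), pack_mul, pack_mul, pack_mul]
    have h := rowHH_check i hi
    simp only [rowHH, pOne, pG, pQ, pH'] at h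
    exact h

/-- This is the welfare constraint with the signed factor `1 + (i - j) / 1000`. The term with `-j`
stands on the right to avoid subtraction, and `lamTab + 10 ^ 5` is the a priori upper bound for the
optimal value. -/
lemma tab_WLL {i j : ℕ} (hi : i < 501) (hj : j < 501) (h : (i, j) ∉ excWLL) :
    (lamTab + 10 ^ 5) * 10 ^ 18 * (1000 + i) + 3 * 10 ^ 31 ≤
      phiTab i * qTab j + 10 ^ 18 * i * rTab j + (1000 - i) * hTab (1000 - j) + qTab i * phiTab j +
        (10 ^ 18 * rTab i + (lamTab + 10 ^ 5) * 10 ^ 18) * j + hTab (1000 - i) * (1000 - j) := by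
  refine le_of_lanesLE (i := i) (j := j) (e := excWLL)
    (v := fun _ => (lamTab + 10 ^ 5) * 10 ^ 18 * (1000 + i) + 3 * 10 ^ 31)
    (w := fun j => phiTab i * qTab j + 10 ^ 18 * i * rTab j + (1000 - i) * hTab (1000 - j) +
      qTab i * phiTab j + (10 ^ 18 * rTab i + (lamTab + 10 ^ 5) * 10 ^ 18) * j +
      hTab (1000 - i) * (1000 - j)) (by decide) (by decide) (fun j hj => ?_)
    (fun j hj => ?_) ?_ hj h
  · simp only [lamTab]; omega
  · calc _ ≤ 10 ^ 21 * (144 * 10 ^ 16) + 10 ^ 18 * 501 * 10 ^ 18 + 1000 * (2 * 10 ^ 36) +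
          144 * 10 ^ 16 * 10 ^ 21 + (10 ^ 18 * 10 ^ 18 + (10 ^ 18 + 10 ^ 5) * 10 ^ 18) * 501 +
          2 * 10 ^ 36 * 1000 := by
          have := qTab_le (show i < 1001 by omega)
          have := qTab_le (show j < 1001 by omega)
          have := rTab_le (show i < 1001 by omega)
          have := rTab_le (show j < 1001 by omega)
          have := hTab_le (show 1000 - i < 1001 by omega)
          have := hTab_le (show 1000 - j < 1001 by omega)
          have := phiTab_le hi
          have := phiTab_le hj
          have : lamTab ≤ 10 ^ 18 := by norm_num [lamTab]
          gcongr <;> omega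
      _ < 2 ^ 158 := by norm_num
  · rw [pack_const, pack_add, pack_add, pack_add, pack_add, pack_add, pack_mul, pack_mul, pack_mul,
      pack_mul, pack_mul, pack_mul]
    have h := rowWLL_check i hi
    simp only [rowWLL, pOne, pIdx, pCoidx, pQ, pR, pH', pPhi] at h
    exact h

lemma tab_WLH {i j : ℕ} (hi : i < 501) (hj : j < 501) (h : (i, j) ∉ excWLH) :
    (lamTab + 10 ^ 5) * 10 ^ 18 * (2000 - i) + 3 * 10 ^ 31 ≤
      phiTab i * qTab (1000 - j) + 10 ^ 18 * i * rTab (1000 - j) + (1000 - i) * hTab j +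
        qTab (1000 - i) * phiTab j +
        (10 ^ 18 * rTab (1000 - i) + (lamTab + 10 ^ 5) * 10 ^ 18) * j + hTab i * (1000 - j) := by
  refine le_of_lanesLE (i := i) (j := j) (e := excWLH)
    (v := fun _ => (lamTab + 10 ^ 5) * 10 ^ 18 * (2000 - i) + 3 * 10 ^ 31)
    (w := fun j => phiTab i * qTab (1000 - j) + 10 ^ 18 * i * rTab (1000 - j) +
      (1000 - i) * hTab j + qTab (1000 - i) * phiTab j +
      (10 ^ 18 * rTab (1000 - i) + (lamTab + 10 ^ 5) * 10 ^ 18) * j +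
      hTab i * (1000 - j)) (by decide) (by decide) (fun j hj => ?_)
    (fun j hj => ?_) ?_ hj h
  · simp only [lamTab]; omega
  · calc _ ≤ 10 ^ 21 * (144 * 10 ^ 16) + 10 ^ 18 * 501 * 10 ^ 18 + 1000 * (2 * 10 ^ 36) +
          144 * 10 ^ 16 * 10 ^ 21 + (10 ^ 18 * 10 ^ 18 + (10 ^ 18 + 10 ^ 5) * 10 ^ 18) * 501 +
          2 * 10 ^ 36 * 1000 := by
          have := qTab_le (show 1000 - i < 1001 by omega)
          have := qTab_le (show 1000 - j < 1001 by omega)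
          have := rTab_le (show 1000 - i < 1001 by omega)
          have := rTab_le (show 1000 - j < 1001 by omega)
          have := hTab_le (show i < 1001 by omega)
          have := hTab_le (show j < 1001 by omega)
          have := phiTab_le hi
          have := phiTab_le hj
          have : lamTab ≤ 10 ^ 18 := by norm_num [lamTab]
          gcongr <;> omega
      _ < 2 ^ 158 := by norm_num
  · rw [pack_const, pack_add, pack_add, pack_add, pack_add, pack_add, pack_mul, pack_mul, pack_mul,
      pack_mul, pack_mul, pack_mul]
    have h := rowWLH_check i hi
    simp only [rowWLH, pOne, pIdx, pCoidx, pQ', pR', pH, pPhi] at h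
    exact h

noncomputable section

/-! ### Accuracy of the logarithm table -/

/-- With `x = 1 / (2 * m + 1)` one has `(m + 1) / m = (1 + x) / (1 - x)`, and `logStep` is the floor
of three terms of the odd power series. The tail and the floor each cost at most one unit. -/
lemma logStep_bounds {m : ℕ} (hm : 500 ≤ m) :
    (logStep m : ℝ) ≤ 10 ^ 18 * Real.log ((m + 1) / m) ∧
      10 ^ 18 * Real.log ((m + 1) / m) ≤ logStep m + 2 := by
  have hm' : (500 : ℝ) ≤ m := by exact_mod_cast hm
  set x : ℝ := 1 / (2 * m + 1) with hx
  have hy : (1001 : ℝ) ≤ 2 * m + 1 := by linarith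
  have hx0 : 0 ≤ x := by positivity
  have hx1 : x ≤ 1 / 1001 := by rw [hx]; gcongr
  have hfrac : (1 + x) / (1 - x) = (m + 1) / m := by
    have h1 : (2 * (m : ℝ) + 1) ≠ 0 := by positivity
    have h2 : (m : ℝ) ≠ 0 := by positivity
    have h3 : 1 - x ≠ 0 := by linarith
    rw [div_eq_div_iff h3 h2, hx]
    field_simp
    ring
  have hlo := Real.sum_range_le_log_div hx0 (by linarith) 3
  have hhi := Real.log_div_le_sum_range_add hx0 (by linarith) 3
  rw [hfrac] at hlo hhi
  have hsum : ∑ i ∈ range 3, x ^ (2 * i + 1) / (2 * i + 1) =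
      (15 * (2 * (m : ℝ) + 1) ^ 4 + 5 * (2 * m + 1) ^ 2 + 3) / (15 * (2 * m + 1) ^ 5) := by
    have h1 : (2 * (m : ℝ) + 1) ≠ 0 := by positivity
    simp only [sum_range_succ, range_zero, sum_empty]
    rw [hx]
    push_cast
    field_simp
    ring
  have htail : x ^ (2 * 3 + 1) / (1 - x ^ 2) ≤ 1 / (2 * 10 ^ 18) := by
    rw [div_le_div_iff₀ (by nlinarith) (by norm_num)]
    have h7 : x ^ 7 ≤ (1 / 1001) ^ 7 := by gcongr
    have h2 : x ^ 2 ≤ (1 / 1001) ^ 2 := by gcongr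
    norm_num at h7 h2 ⊢
    linarith
  have hst : (logStep m : ℝ) ≤ 2 * 10 ^ 18 *
      (15 * (2 * (m : ℝ) + 1) ^ 4 + 5 * (2 * m + 1) ^ 2 + 3) / (15 * (2 * m + 1) ^ 5) ∧
      2 * 10 ^ 18 * (15 * (2 * (m : ℝ) + 1) ^ 4 + 5 * (2 * m + 1) ^ 2 + 3) /
        (15 * (2 * m + 1) ^ 5) ≤ logStep m + 1 := by
    have e : (2 * 10 ^ 18 * (15 * (2 * (m : ℝ) + 1) ^ 4 + 5 * (2 * m + 1) ^ 2 + 3) /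
        (15 * (2 * m + 1) ^ 5) : ℝ) =
        ((2 * 10 ^ 18 * (15 * (2 * m + 1) ^ 4 + 5 * (2 * m + 1) ^ 2 + 3) : ℕ) : ℝ) /
          ((15 * (2 * m + 1) ^ 5 : ℕ) : ℝ) := by norm_num
    rw [e, logStep]
    refine ⟨Nat.cast_div_le, ?_⟩
    rw [div_le_iff₀ (by positivity)]
    have := Nat.lt_div_mul_add (a := 2 * 10 ^ 18 * (15 * (2 * m + 1) ^ 4 + 5 * (2 * m + 1) ^ 2 + 3))
      (b := 15 * (2 * m + 1) ^ 5) (by positivity)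
    rw [← Nat.succ_mul] at this
    exact_mod_cast this.le
  rw [hsum] at hlo hhi
  rw [mul_div_assoc] at hst
  obtain ⟨h1, h2⟩ := hst
  norm_num at hlo hhi htail h1 h2 ⊢
  constructor <;> linarith

/-- The logarithm telescopes. Two units of error per step make at most 1000 over 500 steps, which is
the error in `gTab_gVal`. -/
lemma logTab_log (n : ℕ) :
    (logTab n : ℝ) ≤ 10 ^ 18 * Real.log ((500 + n) / 500) ∧
      10 ^ 18 * Real.log ((500 + n) / 500) ≤ logTab n + 2 * n := by
  induction n with
  | zero => simp [logTab]
  | succ n ih =>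
    have h := logStep_bounds (m := 500 + n) (by omega)
    have e : Real.log ((500 + ((n + 1 : ℕ) : ℝ)) / 500) = Real.log ((500 + n) / 500) +
        Real.log ((((500 + n : ℕ) : ℝ) + 1) / ((500 + n : ℕ) : ℝ)) := by
      rw [← Real.log_mul (by positivity) (by positivity)]
      congr 1
      push_cast
      field_simp
      ring
    rw [e, logTab]
    push_cast at h ⊢
    constructor <;> linarith [h.1, h.2, ih.1, ih.2]

/-- The value of `f₂` at the reflected grid point `1 - j / 1000`. -/
def gVal (j : ℕ) : ℝ := f₂ (1 - j / 1000)

lemma gTab_gVal {j : ℕ} (hj : j ≤ 500) :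
    (gTab j : ℝ) ≤ 10 ^ 18 * gVal j ∧ 10 ^ 18 * gVal j ≤ gTab j + 1000 := by
  obtain ⟨h1, h2⟩ := logTab_log (500 - j)
  have h3 := (logTab_bounds (500 - j) (by omega)).1
  have e1 : (gTab j : ℝ) = logTab (500 - j) - (500 - j) * 10 ^ 15 := by
    rw [gTab, Nat.cast_sub h3, Nat.cast_mul, Nat.cast_sub hj]; norm_num
  rw [Nat.cast_sub hj] at h1 h2
  push_cast at h1 h2
  have e2 : gVal j = Real.log ((500 + (500 - j)) / 500) - (1 - j / 1000) + 1 / 2 := by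
    rw [gVal, f₂]; ring_nf
  have hj0 : (0 : ℝ) ≤ j := by positivity
  rw [e1, e2]
  constructor <;> linarith

end

noncomputable section

/-! ### Constraints between low and high grid points -/

variable {Q R : Fin (1000 + 1) → ℝ}

lemma gridPt_eq (i : Fin (1000 + 1)) : gridPt i = (i : ℕ) / 1000 := by
  simp [gridPt]

lemma gridPt_le_half {i : Fin (1000 + 1)} (hi : (i : ℕ) ≤ 500) : gridPt i ≤ 1 / 2 := by
  have : ((i : ℕ) : ℝ) ≤ 500 := by exact_mod_cast hi
  rw [gridPt_eq]; linarith

lemma alloc_low {i : Fin (1000 + 1)} (hi : (i : ℕ) ≤ 500) (k : Fin (1000 + 1)) :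
    alloc Q R (gridPt i) k = Q k * ((i : ℕ) / 1000) + R k := by
  rw [alloc_of_le (gridPt_le_half hi), gridPt_eq]

lemma alloc_high {i : Fin (1000 + 1)} (hi : (i : ℕ) ≤ 500) (k : Fin (1000 + 1)) :
    alloc Q R (gridPt i.rev) k = Q k / 2 + R k + Q k.rev * gVal i := by
  have := gridPt_le_half hi
  rw [gridPt_rev (by norm_num), alloc_of_ge (by linarith), gVal, gridPt_eq]

lemma gridUtility_low {i : Fin (1000 + 1)} (hi : (i : ℕ) ≤ 500) (k : Fin (1000 + 1)) :
    gridUtility Q R i k = (i : ℕ) / 1000 * (Q k * ((i : ℕ) / 1000) + R k) +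
      (1 - (i : ℕ) / 1000) * (Q k.rev / 2 + R k.rev + Q k * gVal i) := by
  rw [gridUtility, alloc_low hi, alloc_high hi, Fin.rev_rev, gridPt_eq]

lemma gridUtility_rev (i k : Fin (1000 + 1)) :
    gridUtility Q R i.rev k.rev = gridUtility Q R i k := by
  simp only [gridUtility, Fin.rev_rev, gridPt_rev (by norm_num : 0 < 1000)]
  ring

lemma low_or_high (k : Fin (1000 + 1)) :
    (k : ℕ) ≤ 500 ∨ ∃ i : Fin (1000 + 1), (i : ℕ) < 500 ∧ k = i.rev := by
  by_cases h : (k : ℕ) ≤ 500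
  · exact Or.inl h
  · exact Or.inr ⟨k.rev, by rw [Fin.val_rev]; omega, (Fin.rev_rev k).symm⟩

/-- The pairs of grid points in the binding feasibility constraints. -/
def coreF : List (Fin (1000 + 1) × Fin (1000 + 1)) :=
  [(0, 0), (500, 311), (500, 312), (689, 689), (807, 0), (807, 688), (1000, 0), (1000, 193),
    (1000, 632)]

/-- The pairs of grid points in the binding welfare constraints. -/
def coreC : List (Fin (1000 + 1) × Fin (1000 + 1)) :=
  [(193, 0), (311, 0), (312, 0), (368, 0), (500, 193)]

/-- The binding constraints of the linear program. -/
structure CoreFeasible (Q R : Fin (1000 + 1) → ℝ) (lam : ℝ) : Prop where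
  feasible : ∀ p ∈ coreF,
    alloc Q R (gridPt p.1) p.2 + alloc Q R (gridPt p.2) p.1 ≤ 1 - 2.92 / 2000
  competitive : ∀ p ∈ coreC, (1 + |gridPt p.1 - gridPt p.2|) * lam ≤
    gridUtility Q R p.1 p.2 + gridUtility Q R p.2 p.1

/-- `Q` and `R` are close to the table. -/
def NearTable (Q R : Fin (1000 + 1) → ℝ) : Prop :=
  ∀ k : Fin (1000 + 1), |Q k - qTab k / 10 ^ 18| ≤ 1 / 10 ^ 9 ∧
    |R k - rTab k / 10 ^ 18| ≤ 1 / 10 ^ 9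

lemma NearTable.bounds (h : NearTable Q R) (k : Fin (1000 + 1)) :
    Q k ≤ qTab k / 10 ^ 18 + 1 / 10 ^ 9 ∧ qTab k / 10 ^ 18 - 1 / 10 ^ 9 ≤ Q k ∧
      R k ≤ rTab k / 10 ^ 18 + 1 / 10 ^ 9 ∧ rTab k / 10 ^ 18 - 1 / 10 ^ 9 ≤ R k := by
  have h1 := abs_le.1 (h k).1
  have h2 := abs_le.1 (h k).2
  exact ⟨by linarith, by linarith, by linarith, by linarith⟩

lemma gVal_mem {j : ℕ} (hj : j ≤ 500) :
    0 ≤ gVal j ∧ gVal j ≤ 1 / 4 ∧ gTab j / 10 ^ 18 ≤ gVal j ∧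
      gVal j ≤ gTab j / 10 ^ 18 + 1 / 10 ^ 15 := by
  obtain ⟨h1, h2⟩ := gTab_gVal hj
  have h3 : (gTab j : ℝ) ≤ 2 * 10 ^ 17 := by exact_mod_cast gTab_le
  have h4 : (0 : ℝ) ≤ gTab j := by positivity
  refine ⟨by linarith, by linarith, by linarith, by linarith⟩

lemma mul_gVal_le {q : ℕ} {x : ℝ} (hq : q ≤ 144 * 10 ^ 16) (hx : x ≤ q / 10 ^ 18 + 1 / 10 ^ 9)
    {j : ℕ} (hj : j ≤ 500) :
    x * gVal j ≤ (q * gTab j : ℕ) / 10 ^ 36 + 3 / 10 ^ 10 := by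
  obtain ⟨h0, h1, h2, h3⟩ := gVal_mem hj
  have hq' : (q : ℝ) ≤ 144 * 10 ^ 16 := by exact_mod_cast hq
  have hq0 : (0 : ℝ) ≤ q := by positivity
  have a1 := mul_le_mul_of_nonneg_right hx h0
  have a2 := mul_le_mul_of_nonneg_left h3 (by positivity : (0 : ℝ) ≤ q / 10 ^ 18)
  push_cast
  have a3 : (q : ℝ) / 10 ^ 18 * (gTab j / 10 ^ 18 + 1 / 10 ^ 15) =
    q * gTab j / 10 ^ 36 + q / 10 ^ 33 := by ring
  linarith

lemma le_mul_gVal {q : ℕ} {x : ℝ} (hx : q / 10 ^ 18 - 1 / 10 ^ 9 ≤ x) {j : ℕ} (hj : j ≤ 500) :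
    (q * gTab j : ℕ) / 10 ^ 36 - 3 / 10 ^ 10 ≤ x * gVal j := by
  obtain ⟨h0, h1, h2, h3⟩ := gVal_mem hj
  have a1 := mul_le_mul_of_nonneg_right hx h0
  have a2 := mul_le_mul_of_nonneg_left h2 (by positivity : (0 : ℝ) ≤ q / 10 ^ 18)
  push_cast
  have a3 : (q : ℝ) / 10 ^ 18 * (gTab j / 10 ^ 18) = q * gTab j / 10 ^ 36 := by ring
  linarith

lemma hTab_cast (k : ℕ) :
    (hTab k : ℝ) / 10 ^ 36 = qTab k / 10 ^ 18 / 2 + rTab k / 10 ^ 18 := by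
  rw [hTab]; push_cast; ring

lemma val_rev_low {j : Fin (1000 + 1)} : (j.rev : ℕ) = 1000 - j := by
  rw [Fin.val_rev]; omega

/-- Changing each entry by `10⁻⁹` raises the left side by at most `3 * 10⁻⁹`, within the margin of
`tab_LL`. -/
lemma feasible_low_low (h : NearTable Q R) {i j : Fin (1000 + 1)} (hi : (i : ℕ) ≤ 500)
    (hj : (j : ℕ) ≤ 500) (hij : ((i : ℕ), (j : ℕ)) ∉ excLL) :
    alloc Q R (gridPt i) j + alloc Q R (gridPt j) i ≤ 1 - 2.92 / 2000 := by
  rw [alloc_low hi, alloc_low hj]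
  obtain ⟨a1, -, a2, -⟩ := h.bounds i
  obtain ⟨b1, -, b2, -⟩ := h.bounds j
  have hi' : ((i : ℕ) : ℝ) ≤ 500 := by exact_mod_cast hi
  have hj' : ((j : ℕ) : ℝ) ≤ 500 := by exact_mod_cast hj
  have hi0 : (0 : ℝ) ≤ (i : ℕ) := by positivity
  have hj0 : (0 : ℝ) ≤ (j : ℕ) := by positivity
  have t := tab_LL (Nat.lt_succ_of_le hi) (Nat.lt_succ_of_le hj) hij
  have t' : (qTab i : ℝ) * (j : ℕ) + (i : ℕ) * qTab j + 1000 * rTab j +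
      (1000 * rTab i + 3 * 10 ^ 13) ≤ 99854 * 10 ^ 16 := by exact_mod_cast t
  have c1 := mul_le_mul_of_nonneg_right b1 (by positivity : (0 : ℝ) ≤ (i : ℕ) / 1000)
  have c2 := mul_le_mul_of_nonneg_right a1 (by positivity : (0 : ℝ) ≤ (j : ℕ) / 1000)
  linarith

lemma feasible_low_high (h : NearTable Q R) {i j : Fin (1000 + 1)} (hi : (i : ℕ) ≤ 500)
    (hj : (j : ℕ) ≤ 500) (hij : ((i : ℕ), (j : ℕ)) ∉ excLH) :
    alloc Q R (gridPt i) j.rev + alloc Q R (gridPt j.rev) i ≤ 1 - 2.92 / 2000 := by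
  rw [alloc_low hi, alloc_high hj]
  obtain ⟨a1, -, a2, -⟩ := h.bounds i
  obtain ⟨a3, -, -, -⟩ := h.bounds i.rev
  obtain ⟨b1, -, b2, -⟩ := h.bounds j.rev
  rw [val_rev_low] at a3 b1 b2
  have hi' : ((i : ℕ) : ℝ) ≤ 500 := by exact_mod_cast hi
  have hi0 : (0 : ℝ) ≤ (i : ℕ) := by positivity
  have t := tab_LH (Nat.lt_succ_of_le hi) (Nat.lt_succ_of_le hj) hij
  have t' : ((qTab (1000 - i) * gTab j : ℕ) : ℝ) + 10 ^ 15 * (i : ℕ) * qTab (1000 - j) +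
      10 ^ 18 * rTab (1000 - j) + (hTab i + 3 * 10 ^ 28) ≤ 99854 * 10 ^ 31 := by exact_mod_cast t
  have c1 := mul_le_mul_of_nonneg_right b1 (by positivity : (0 : ℝ) ≤ (i : ℕ) / 1000)
  have c2 := mul_gVal_le (qTab_le (by omega)) a3 hj
  have e1 := hTab_cast i
  linarith

lemma feasible_high_high (h : NearTable Q R) {i j : Fin (1000 + 1)} (hi : (i : ℕ) ≤ 500)
    (hj : (j : ℕ) ≤ 500) (hij : ((i : ℕ), (j : ℕ)) ∉ excHH) :
    alloc Q R (gridPt i.rev) j.rev + alloc Q R (gridPt j.rev) i.rev ≤ 1 - 2.92 / 2000 := by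
  rw [alloc_high hi, alloc_high hj, Fin.rev_rev, Fin.rev_rev]
  obtain ⟨a1, -, a2, -⟩ := h.bounds i.rev
  obtain ⟨a3, -, -, -⟩ := h.bounds i
  obtain ⟨b1, -, b2, -⟩ := h.bounds j.rev
  obtain ⟨b3, -, -, -⟩ := h.bounds j
  rw [val_rev_low] at a1 a2 b1 b2
  have t := tab_HH (Nat.lt_succ_of_le hi) (Nat.lt_succ_of_le hj) hij
  have t' : ((qTab i * gTab j : ℕ) : ℝ) + (qTab j * gTab i : ℕ) + hTab (1000 - j) +
      (hTab (1000 - i) + 3 * 10 ^ 28) ≤ 99854 * 10 ^ 31 := by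
    rw [mul_comm (qTab j), ← one_mul (hTab (1000 - j))]; exact_mod_cast t
  have c1 := mul_gVal_le (qTab_le (by omega)) a3 hj
  have c2 := mul_gVal_le (qTab_le (by omega)) b3 hi
  have e1 := hTab_cast (1000 - i)
  have e2 := hTab_cast (1000 - j)
  linarith

/-- A lower bound for the utility of an agent at a low grid point, in terms of the table. -/
lemma gridUtility_ge {q r h' : ℕ} {i k : Fin (1000 + 1)} (hi : (i : ℕ) ≤ 500)
    (hq : q / 10 ^ 18 - 1 / 10 ^ 9 ≤ Q k) (hr : r / 10 ^ 18 - 1 / 10 ^ 9 ≤ R k)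
    (hh : h' / 10 ^ 36 - 2 / 10 ^ 9 ≤ Q k.rev / 2 + R k.rev) :
    ((phiTab i * q + 10 ^ 18 * i * r + (1000 - i) * h' : ℕ) : ℝ) / 10 ^ 39 - 4 / 10 ^ 9 ≤
      gridUtility Q R i k := by
  have hi' : ((i : ℕ) : ℝ) ≤ 500 := by exact_mod_cast hi
  have hi0 : (0 : ℝ) ≤ (i : ℕ) := by positivity
  have ht0 : (0 : ℝ) ≤ (i : ℕ) / 1000 := by positivity
  have ht1 : (0 : ℝ) ≤ 1 - (i : ℕ) / 1000 := by linarith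
  rw [gridUtility_low hi]
  have c1 := mul_le_mul_of_nonneg_left hq (mul_nonneg ht0 ht0)
  have c2 := mul_le_mul_of_nonneg_left hr ht0
  have c3 := mul_le_mul_of_nonneg_left (add_le_add hh (le_mul_gVal hq hi)) ht1
  have c4 : ((i : ℕ) / 1000 * ((i : ℕ) / 1000) : ℝ) ≤ 1 / 4 := by nlinarith
  have e : ((phiTab i * q + 10 ^ 18 * i * r + (1000 - i) * h' : ℕ) : ℝ) / 10 ^ 39 =
      (i : ℕ) / 1000 * ((i : ℕ) / 1000) * (q / 10 ^ 18) + (i : ℕ) / 1000 * (r / 10 ^ 18) +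
        (1 - (i : ℕ) / 1000) * (h' / 10 ^ 36 + (q * gTab i : ℕ) / 10 ^ 36) := by
    rw [phiTab]
    push_cast [Nat.cast_sub (show (i : ℕ) ≤ 1000 by omega)]
    ring
  rw [e]
  nlinarith

/-- The two utility errors add up to `8 * 10⁻⁹`, below the margin `3 * 10⁻⁸`. -/
lemma welfare_combine {A B C D U V : ℝ} (a : A / 10 ^ 39 - 4 / 10 ^ 9 ≤ U)
    (b : B / 10 ^ 39 - 4 / 10 ^ 9 ≤ V) (h : D ≤ A + B + C) :
    D / 10 ^ 39 - 3 / 10 ^ 8 - C / 10 ^ 39 ≤ U + V := by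
  linarith

lemma competitive_low_low (h : NearTable Q R) {lam : ℝ} (hl : lam ≤ (lamTab + 10 ^ 5) / 10 ^ 18)
    {i j : Fin (1000 + 1)} (hi : (i : ℕ) ≤ 500) (hj : (j : ℕ) ≤ 500)
    (hij : ((i : ℕ), (j : ℕ)) ∉ excWLL) :
    (1 + (gridPt i - gridPt j)) * lam ≤ gridUtility Q R i j + gridUtility Q R j i := by
  have key : ∀ k : Fin (1000 + 1),
      (hTab (1000 - k) : ℝ) / 10 ^ 36 - 2 / 10 ^ 9 ≤ Q k.rev / 2 + R k.rev := by
    intro k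
    obtain ⟨-, b1, -, b2⟩ := h.bounds k.rev
    rw [val_rev_low] at b1 b2
    rw [hTab_cast]; linarith
  have a := gridUtility_ge hi (h.bounds j).2.1 (h.bounds j).2.2.2 (key j)
  have b := gridUtility_ge hj (h.bounds i).2.1 (h.bounds i).2.2.2 (key i)
  have hj' : ((j : ℕ) : ℝ) ≤ 500 := by exact_mod_cast hj
  have hi0 : (0 : ℝ) ≤ (i : ℕ) := by positivity
  have t := tab_WLL (Nat.lt_succ_of_le hi) (Nat.lt_succ_of_le hj) hij
  have t' : (((lamTab + 10 ^ 5) * 10 ^ 18 * (1000 + i) + 3 * 10 ^ 31 : ℕ) : ℝ) ≤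
      ((phiTab i * qTab j + 10 ^ 18 * i * rTab j + (1000 - i) * hTab (1000 - j) : ℕ) : ℝ) +
      ((phiTab j * qTab i + 10 ^ 18 * j * rTab i + (1000 - j) * hTab (1000 - i) : ℕ) : ℝ) +
      (((lamTab + 10 ^ 5) * 10 ^ 18 * j : ℕ) : ℝ) := by
    rw [← Nat.cast_add, ← Nat.cast_add, Nat.cast_le]
    refine t.trans (le_of_eq ?_)
    ring
  rw [gridPt_eq, gridPt_eq]
  have c := mul_le_mul_of_nonneg_left hl
    (by linarith : (0 : ℝ) ≤ 1 + ((i : ℕ) / 1000 - (j : ℕ) / 1000))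
  refine c.trans ?_
  have e : (1 + (((i : ℕ) : ℝ) / 1000 - (j : ℕ) / 1000)) * ((lamTab + 10 ^ 5) / 10 ^ 18) =
      (((lamTab + 10 ^ 5) * 10 ^ 18 * (1000 + i) + 3 * 10 ^ 31 : ℕ) : ℝ) / 10 ^ 39 - 3 / 10 ^ 8 -
      (((lamTab + 10 ^ 5) * 10 ^ 18 * j : ℕ) : ℝ) / 10 ^ 39 := by
    push_cast; ring
  rw [e]
  exact welfare_combine a b t'

/-- A high point is treated by reflecting both types. Its distance to a low point is `1 - (i + j) /
1000`, so the sign inside the absolute value is known. -/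
lemma competitive_low_high (h : NearTable Q R) {lam : ℝ} (hl : lam ≤ (lamTab + 10 ^ 5) / 10 ^ 18)
    {i j : Fin (1000 + 1)} (hi : (i : ℕ) ≤ 500) (hj : (j : ℕ) ≤ 500)
    (hij : ((i : ℕ), (j : ℕ)) ∉ excWLH) :
    (1 + |gridPt i - gridPt j.rev|) * lam ≤
      gridUtility Q R i j.rev + gridUtility Q R j.rev i := by
  have key : ∀ k : Fin (1000 + 1),
      (hTab k : ℝ) / 10 ^ 36 - 2 / 10 ^ 9 ≤ Q k.rev.rev / 2 + R k.rev.rev := by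
    intro k
    obtain ⟨-, b1, -, b2⟩ := h.bounds k
    rw [Fin.rev_rev, hTab_cast]; linarith
  have rev : gridUtility Q R j.rev i = gridUtility Q R j i.rev := by
    rw [← gridUtility_rev, Fin.rev_rev]
  obtain ⟨-, b1, -, b2⟩ := h.bounds j.rev
  obtain ⟨-, b3, -, b4⟩ := h.bounds i.rev
  rw [val_rev_low] at b1 b2 b3 b4
  have a := gridUtility_ge hi b1 b2 (key j)
  have b := gridUtility_ge hj b3 b4 (key i)
  have hi' : ((i : ℕ) : ℝ) ≤ 500 := by exact_mod_cast hi
  have hj' : ((j : ℕ) : ℝ) ≤ 500 := by exact_mod_cast hj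
  have t := tab_WLH (Nat.lt_succ_of_le hi) (Nat.lt_succ_of_le hj) hij
  have t' : (((lamTab + 10 ^ 5) * 10 ^ 18 * (2000 - i) + 3 * 10 ^ 31 : ℕ) : ℝ) ≤
      ((phiTab i * qTab (1000 - j) + 10 ^ 18 * i * rTab (1000 - j) + (1000 - i) * hTab j : ℕ) : ℝ) +
      ((phiTab j * qTab (1000 - i) + 10 ^ 18 * j * rTab (1000 - i) + (1000 - j) * hTab i : ℕ) : ℝ) +
      (((lamTab + 10 ^ 5) * 10 ^ 18 * j : ℕ) : ℝ) := by
    rw [← Nat.cast_add, ← Nat.cast_add, Nat.cast_le]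
    refine t.trans (le_of_eq ?_)
    ring
  rw [gridPt_rev (by norm_num), gridPt_eq, gridPt_eq, rev, abs_of_nonpos (by linarith)]
  have c := mul_le_mul_of_nonneg_left hl
    (by linarith : (0 : ℝ) ≤ 1 + -((i : ℕ) / 1000 - (1 - (j : ℕ) / 1000)))
  refine c.trans ?_
  have e : (1 + -(((i : ℕ) : ℝ) / 1000 - (1 - (j : ℕ) / 1000))) *
        ((lamTab + 10 ^ 5) / 10 ^ 18) =
      (((lamTab + 10 ^ 5) * 10 ^ 18 * (2000 - i) + 3 * 10 ^ 31 : ℕ) : ℝ) / 10 ^ 39 - 3 / 10 ^ 8 -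
      (((lamTab + 10 ^ 5) * 10 ^ 18 * j : ℕ) : ℝ) / 10 ^ 39 := by
    push_cast [Nat.cast_sub (show (i : ℕ) ≤ 2000 by omega)]; ring
  rw [e]
  exact welfare_combine a b t'

end

/-! ### Sufficiency of the binding constraints near the table -/

noncomputable section

variable {Q R : Fin (1000 + 1) → ℝ}

lemma core_low_low (h : NearTable Q R) {lam : ℝ} (hc : CoreFeasible Q R lam)
    {i j : Fin (1000 + 1)} (hi : (i : ℕ) ≤ 500) (hj : (j : ℕ) ≤ 500) :
    alloc Q R (gridPt i) j + alloc Q R (gridPt j) i ≤ 1 - 2.92 / 2000 := by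
  by_cases hij : ((i : ℕ), (j : ℕ)) ∈ excLL
  · simp only [excLL, List.mem_cons, Prod.mk.injEq, List.not_mem_nil, or_false] at hij
    rcases hij with ⟨a, b⟩ | ⟨a, b⟩ | ⟨a, b⟩ | ⟨a, b⟩ | ⟨a, b⟩
    · obtain rfl : i = 0 := Fin.ext a
      obtain rfl : j = 0 := Fin.ext b
      exact hc.feasible (0, 0) (by decide)
    · obtain rfl : i = 311 := Fin.ext a
      obtain rfl : j = 500 := Fin.ext b
      rw [add_comm]; exact hc.feasible (500, 311) (by decide)
    · obtain rfl : i = 500 := Fin.ext a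
      obtain rfl : j = 311 := Fin.ext b
      exact hc.feasible (500, 311) (by decide)
    · obtain rfl : i = 312 := Fin.ext a
      obtain rfl : j = 500 := Fin.ext b
      rw [add_comm]; exact hc.feasible (500, 312) (by decide)
    · obtain rfl : i = 500 := Fin.ext a
      obtain rfl : j = 312 := Fin.ext b
      exact hc.feasible (500, 312) (by decide)
  · exact feasible_low_low h hi hj hij

lemma core_low_high (h : NearTable Q R) {lam : ℝ} (hc : CoreFeasible Q R lam)
    {i j : Fin (1000 + 1)} (hi : (i : ℕ) ≤ 500) (hj : (j : ℕ) < 500) :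
    alloc Q R (gridPt i) j.rev + alloc Q R (gridPt j.rev) i ≤ 1 - 2.92 / 2000 := by
  by_cases hij : ((i : ℕ), (j : ℕ)) ∈ excLH
  · simp only [excLH, List.mem_cons, Prod.mk.injEq, List.not_mem_nil, or_false] at hij
    rcases hij with ⟨a, b⟩ | ⟨a, b⟩ | ⟨a, b⟩ | ⟨a, b⟩ | ⟨a, b⟩
    · obtain rfl : i = 0 := Fin.ext a
      obtain rfl : j = 193 := Fin.ext b
      rw [add_comm]; exact hc.feasible (807, 0) (by decide)
    · obtain rfl : i = 0 := Fin.ext a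
      obtain rfl : j = 0 := Fin.ext b
      rw [add_comm]; exact hc.feasible (1000, 0) (by decide)
    · obtain rfl : i = 193 := Fin.ext a
      obtain rfl : j = 0 := Fin.ext b
      rw [add_comm]; exact hc.feasible (1000, 193) (by decide)
    -- As a high point, index 500 is the low point 500 again, so these exceptions are excluded by `j
    -- < 500`.
    · omega
    · omega
  · exact feasible_low_high h hi hj.le hij

lemma core_high_high (h : NearTable Q R) {lam : ℝ} (hc : CoreFeasible Q R lam)
    {i j : Fin (1000 + 1)} (hi : (i : ℕ) ≤ 500) (hj : (j : ℕ) ≤ 500) :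
    alloc Q R (gridPt i.rev) j.rev + alloc Q R (gridPt j.rev) i.rev ≤ 1 - 2.92 / 2000 := by
  by_cases hij : ((i : ℕ), (j : ℕ)) ∈ excHH
  · simp only [excHH, List.mem_cons, Prod.mk.injEq, List.not_mem_nil, or_false] at hij
    rcases hij with ⟨a, b⟩ | ⟨a, b⟩ | ⟨a, b⟩ | ⟨a, b⟩ | ⟨a, b⟩
    · obtain rfl : i = 311 := Fin.ext a
      obtain rfl : j = 311 := Fin.ext b
      exact hc.feasible (689, 689) (by decide)
    · obtain rfl : i = 193 := Fin.ext a
      obtain rfl : j = 312 := Fin.ext b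
      exact hc.feasible (807, 688) (by decide)
    · obtain rfl : i = 312 := Fin.ext a
      obtain rfl : j = 193 := Fin.ext b
      rw [add_comm]; exact hc.feasible (807, 688) (by decide)
    · obtain rfl : i = 0 := Fin.ext a
      obtain rfl : j = 368 := Fin.ext b
      exact hc.feasible (1000, 632) (by decide)
    · obtain rfl : i = 368 := Fin.ext a
      obtain rfl : j = 0 := Fin.ext b
      rw [add_comm]; exact hc.feasible (1000, 632) (by decide)
  · exact feasible_high_high h hi hj hij

lemma core_welfare {lam : ℝ} (hc : CoreFeasible Q R lam)
    {i j : Fin (1000 + 1)} (hij : (i, j) ∈ coreC ∨ (j, i) ∈ coreC) :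
    (1 + |gridPt i - gridPt j|) * lam ≤ gridUtility Q R i j + gridUtility Q R j i := by
  rcases hij with hij | hij
  · exact hc.competitive (i, j) hij
  · rw [abs_sub_comm, add_comm (gridUtility Q R i j)]
    exact hc.competitive (j, i) hij

lemma excWLL_symm {i j : ℕ} (h : (i, j) ∈ excWLL) : (j, i) ∈ excWLL := by
  simp only [excWLL, List.mem_cons, Prod.mk.injEq, List.not_mem_nil, or_false] at h
  rcases h with ⟨rfl, rfl⟩ | ⟨rfl, rfl⟩ | ⟨rfl, rfl⟩ | ⟨rfl, rfl⟩ | ⟨rfl, rfl⟩ | ⟨rfl, rfl⟩ |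
    ⟨rfl, rfl⟩ | ⟨rfl, rfl⟩ | ⟨rfl, rfl⟩ | ⟨rfl, rfl⟩ <;> decide

lemma core_welfare_low_low (h : NearTable Q R) {lam : ℝ} (hl : lam ≤ (lamTab + 10 ^ 5) / 10 ^ 18)
    (hc : CoreFeasible Q R lam)
    {i j : Fin (1000 + 1)} (hi : (i : ℕ) ≤ 500) (hj : (j : ℕ) ≤ 500) :
    (1 + |gridPt i - gridPt j|) * lam ≤ gridUtility Q R i j + gridUtility Q R j i := by
  by_cases hij : ((i : ℕ), (j : ℕ)) ∈ excWLL
  · refine core_welfare hc ?_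
    simp only [excWLL, List.mem_cons, Prod.mk.injEq, List.not_mem_nil, or_false] at hij
    simp only [coreC, List.mem_cons, Prod.mk.injEq, List.not_mem_nil, or_false, Fin.ext_iff]
    rcases hij with ⟨a, b⟩ | ⟨a, b⟩ | ⟨a, b⟩ | ⟨a, b⟩ | ⟨a, b⟩ | ⟨a, b⟩ | ⟨a, b⟩ | ⟨a, b⟩ |
      ⟨a, b⟩ | ⟨a, b⟩ <;> rw [a, b] <;> decide
  · have hji : ((j : ℕ), (i : ℕ)) ∉ excWLL := fun hji => hij (excWLL_symm hji)
    have a := competitive_low_low h hl hi hj hij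
    have b := competitive_low_low h hl hj hi hji
    rcases abs_cases (gridPt i - gridPt j) with ⟨e, -⟩ | ⟨e, -⟩
    · rw [e]; exact a
    · rw [e, neg_sub]; linarith

lemma core_welfare_low_high (h : NearTable Q R) {lam : ℝ} (hl : lam ≤ (lamTab + 10 ^ 5) / 10 ^ 18)
    (hc : CoreFeasible Q R lam)
    {i j : Fin (1000 + 1)} (hi : (i : ℕ) ≤ 500) (hj : (j : ℕ) < 500) :
    (1 + |gridPt i - gridPt j.rev|) * lam ≤ gridUtility Q R i j.rev + gridUtility Q R j.rev i := by
  by_cases hij : ((i : ℕ), (j : ℕ)) ∈ excWLH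
  · simp only [excWLH, List.mem_cons, Prod.mk.injEq, List.not_mem_nil, or_false] at hij
    rcases hij with ⟨a, b⟩ | ⟨a, b⟩
    · omega
    · obtain rfl : i = 500 := Fin.ext a
      obtain rfl : j = 193 := Fin.ext b
      -- The midpoint is its own reflection, so the pair `(500, 807)` is the mirror image of the
      -- binding pair `(500, 193)`.
      have e : (500 : Fin (1000 + 1)) = (500 : Fin (1000 + 1)).rev := by decide
      have := hc.competitive (500, 193) (by decide)
      rw [e, gridUtility_rev, gridUtility_rev, gridPt_rev (by norm_num),
        gridPt_rev (by norm_num), sub_sub_sub_cancel_left, abs_sub_comm]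
      exact this
  · exact competitive_low_high h hl hi hj.le hij

/-- Near the table, the binding constraints imply all constraints of the linear program. -/
theorem lpFeasible_of_coreFeasible (h : NearTable Q R) (h0 : ∀ k, 0 ≤ Q k ∧ 0 ≤ R k) {lam : ℝ}
    (hl : lam ≤ (lamTab + 10 ^ 5) / 10 ^ 18) (hc : CoreFeasible Q R lam) :
    LPFeasible 1000 (2.92 / 2000) Q R lam := by
  refine ⟨fun k l => ?_, fun k l => ?_, h0⟩
  · rcases low_or_high k with hk | ⟨i, hi, rfl⟩ <;> rcases low_or_high l with hj | ⟨j, hj, rfl⟩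
    · exact core_low_low h hc hk hj
    · exact core_low_high h hc hk hj
    · rw [add_comm]; exact core_low_high h hc hj hi
    · exact core_high_high h hc hi.le hj.le
  · rcases low_or_high k with hk | ⟨i, hi, rfl⟩ <;> rcases low_or_high l with hj | ⟨j, hj, rfl⟩
    · exact core_welfare_low_low h hl hc hk hj
    · exact core_welfare_low_high h hl hc hk hj
    · rw [abs_sub_comm, add_comm (gridUtility Q R i.rev l)]
      exact core_welfare_low_high h hl hc hj hi
    · rw [gridUtility_rev, gridUtility_rev, gridPt_rev (by norm_num), gridPt_rev (by norm_num),
        sub_sub_sub_cancel_left, abs_sub_comm]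
      exact core_welfare_low_low h hl hc hi.le hj.le

/-- Every solution of the linear program satisfies the binding constraints. -/
lemma LPFeasible.coreFeasible {lam : ℝ} (h : LPFeasible 1000 (2.92 / 2000) Q R lam) :
    CoreFeasible Q R lam :=
  ⟨fun p _ => h.feasible p.1 p.2, fun p _ => h.competitive p.1 p.2⟩

end

noncomputable section

/-! ### The binding constraints in explicit form -/

variable {Q R : Fin (1000 + 1) → ℝ}

lemma rev_core : (0 : Fin (1000 + 1)).rev = 1000 ∧ (193 : Fin (1000 + 1)).rev = 807 ∧
    (311 : Fin (1000 + 1)).rev = 689 ∧ (312 : Fin (1000 + 1)).rev = 688 ∧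
    (368 : Fin (1000 + 1)).rev = 632 ∧ (500 : Fin (1000 + 1)).rev = 500 := by
  decide

lemma rev_core' : (1000 : Fin (1000 + 1)).rev = 0 ∧ (807 : Fin (1000 + 1)).rev = 193 ∧
    (689 : Fin (1000 + 1)).rev = 311 ∧ (688 : Fin (1000 + 1)).rev = 312 ∧
    (632 : Fin (1000 + 1)).rev = 368 := by
  decide

lemma gVal_500 : gVal 500 = 0 := by
  rw [gVal]; norm_num; simpa using f₂_half

/-- The binding constraints, spelled out. -/
lemma coreFeasible_iff (lam : ℝ) : CoreFeasible Q R lam ↔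
    (2 * R 0 ≤ 49927 / 50000 ∧
    Q 311 / 2 + R 311 + 311 / 1000 * Q 500 + R 500 ≤ 49927 / 50000 ∧
    Q 312 / 2 + R 312 + 312 / 1000 * Q 500 + R 500 ≤ 49927 / 50000 ∧
    2 * (Q 689 / 2 + R 689 + Q 311 * gVal 311) ≤ 49927 / 50000 ∧
    Q 0 / 2 + R 0 + Q 1000 * gVal 193 + R 807 ≤ 49927 / 50000 ∧
    Q 688 / 2 + R 688 + Q 312 * gVal 193 + (Q 807 / 2 + R 807 + Q 193 * gVal 312) ≤
      49927 / 50000 ∧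
    Q 0 / 2 + R 0 + Q 1000 * gVal 0 + R 1000 ≤ 49927 / 50000 ∧
    Q 193 / 2 + R 193 + Q 807 * gVal 0 + (193 / 1000 * Q 1000 + R 1000) ≤ 49927 / 50000 ∧
    Q 632 / 2 + R 632 + Q 368 * gVal 0 + (Q 1000 / 2 + R 1000 + Q 0 * gVal 368) ≤
      49927 / 50000) ∧
    (1193 / 1000 * lam ≤ 193 / 1000 * (Q 0 * (193 / 1000) + R 0) +
      807 / 1000 * (Q 1000 / 2 + R 1000 + Q 0 * gVal 193) +
      (Q 807 / 2 + R 807 + Q 193 * gVal 0) ∧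
    1311 / 1000 * lam ≤ 311 / 1000 * (Q 0 * (311 / 1000) + R 0) +
      689 / 1000 * (Q 1000 / 2 + R 1000 + Q 0 * gVal 311) +
      (Q 689 / 2 + R 689 + Q 311 * gVal 0) ∧
    1312 / 1000 * lam ≤ 312 / 1000 * (Q 0 * (312 / 1000) + R 0) +
      688 / 1000 * (Q 1000 / 2 + R 1000 + Q 0 * gVal 312) +
      (Q 688 / 2 + R 688 + Q 312 * gVal 0) ∧
    1368 / 1000 * lam ≤ 368 / 1000 * (Q 0 * (368 / 1000) + R 0) +
      632 / 1000 * (Q 1000 / 2 + R 1000 + Q 0 * gVal 368) +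
      (Q 632 / 2 + R 632 + Q 368 * gVal 0) ∧
    1307 / 1000 * lam ≤ 1 / 2 * (Q 193 / 2 + R 193) + 1 / 2 * (Q 807 / 2 + R 807) +
      (193 / 1000 * (Q 500 * (193 / 1000) + R 500) +
        807 / 1000 * (Q 500 / 2 + R 500 + Q 500 * gVal 193))) := by
  obtain ⟨v0, v1, v2, v3, v4, v5⟩ := rev_core
  obtain ⟨u0, u1, u2, u3, u4⟩ := rev_core'
  have l0 : ∀ k, alloc Q R (gridPt 0) k = R k := fun k => by
    rw [alloc_low (i := 0) (by decide)]; simp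
  have l193 : ∀ k, alloc Q R (gridPt 193) k = Q k * (193 / 1000) + R k :=
    fun k => alloc_low (i := 193) (by decide) k
  have l311 : ∀ k, alloc Q R (gridPt 311) k = Q k * (311 / 1000) + R k :=
    fun k => alloc_low (i := 311) (by decide) k
  have l312 : ∀ k, alloc Q R (gridPt 312) k = Q k * (312 / 1000) + R k :=
    fun k => alloc_low (i := 312) (by decide) k
  have l500 : ∀ k, alloc Q R (gridPt 500) k = Q k * (500 / 1000) + R k :=
    fun k => alloc_low (i := 500) (by decide) k
  have h1000 : ∀ k, alloc Q R (gridPt 1000) k = Q k / 2 + R k + Q k.rev * gVal 0 := fun k => by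
    rw [← v0]; exact alloc_high (i := 0) (by decide) k
  have h807 : ∀ k, alloc Q R (gridPt 807) k = Q k / 2 + R k + Q k.rev * gVal 193 := fun k => by
    rw [← v1]; exact alloc_high (i := 193) (by decide) k
  have h689 : ∀ k, alloc Q R (gridPt 689) k = Q k / 2 + R k + Q k.rev * gVal 311 := fun k => by
    rw [← v2]; exact alloc_high (i := 311) (by decide) k
  have h688 : ∀ k, alloc Q R (gridPt 688) k = Q k / 2 + R k + Q k.rev * gVal 312 := fun k => by
    rw [← v3]; exact alloc_high (i := 312) (by decide) k
  have h632 : ∀ k, alloc Q R (gridPt 632) k = Q k / 2 + R k + Q k.rev * gVal 368 := fun k => by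
    rw [← v4]; exact alloc_high (i := 368) (by decide) k
  have w0 : ∀ k, gridUtility Q R 0 k = Q k.rev / 2 + R k.rev + Q k * gVal 0 := fun k => by
    rw [gridUtility_low (i := 0) (by decide)]; simp
  have w193 : ∀ k, gridUtility Q R 193 k = 193 / 1000 * (Q k * (193 / 1000) + R k) +
      (1 - 193 / 1000) * (Q k.rev / 2 + R k.rev + Q k * gVal 193) :=
    fun k => gridUtility_low (i := 193) (by decide) k
  have w311 : ∀ k, gridUtility Q R 311 k = 311 / 1000 * (Q k * (311 / 1000) + R k) +
      (1 - 311 / 1000) * (Q k.rev / 2 + R k.rev + Q k * gVal 311) :=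
    fun k => gridUtility_low (i := 311) (by decide) k
  have w312 : ∀ k, gridUtility Q R 312 k = 312 / 1000 * (Q k * (312 / 1000) + R k) +
      (1 - 312 / 1000) * (Q k.rev / 2 + R k.rev + Q k * gVal 312) :=
    fun k => gridUtility_low (i := 312) (by decide) k
  have w368 : ∀ k, gridUtility Q R 368 k = 368 / 1000 * (Q k * (368 / 1000) + R k) +
      (1 - 368 / 1000) * (Q k.rev / 2 + R k.rev + Q k * gVal 368) :=
    fun k => gridUtility_low (i := 368) (by decide) k
  have w500 : ∀ k, gridUtility Q R 500 k = 500 / 1000 * (Q k * (500 / 1000) + R k) +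
      (1 - 500 / 1000) * (Q k.rev / 2 + R k.rev + Q k * gVal 500) :=
    fun k => gridUtility_low (i := 500) (by decide) k
  have t0 : gridPt (0 : Fin (1000 + 1)) = 0 := by rw [gridPt_eq]; simp
  have t193 : gridPt (193 : Fin (1000 + 1)) = 193 / 1000 := gridPt_eq 193
  have t311 : gridPt (311 : Fin (1000 + 1)) = 311 / 1000 := gridPt_eq 311
  have t312 : gridPt (312 : Fin (1000 + 1)) = 312 / 1000 := gridPt_eq 312
  have t368 : gridPt (368 : Fin (1000 + 1)) = 368 / 1000 := gridPt_eq 368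
  have t500 : gridPt (500 : Fin (1000 + 1)) = 500 / 1000 := gridPt_eq 500
  have d : |(500 / 1000 - 193 / 1000 : ℝ)| = 307 / 1000 := by norm_num
  have d' : ∀ n : ℕ, |((n : ℝ) / 1000)| = n / 1000 := fun n => abs_of_nonneg (by positivity)
  have hiff : CoreFeasible Q R lam ↔
      (∀ p ∈ coreF, alloc Q R (gridPt p.1) p.2 + alloc Q R (gridPt p.2) p.1 ≤ 1 - 2.92 / 2000) ∧
      (∀ p ∈ coreC, (1 + |gridPt p.1 - gridPt p.2|) * lam ≤
        gridUtility Q R p.1 p.2 + gridUtility Q R p.2 p.1) :=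
    ⟨fun h => ⟨h.1, h.2⟩, fun h => ⟨h.1, h.2⟩⟩
  rw [hiff]
  simp only [coreF, coreC, List.forall_mem_cons, List.not_mem_nil, IsEmpty.forall_iff,
    implies_true, and_true, l0, l193, l311, l312, l500, h1000, h807, h689, h688, h632, u0, u1, u2,
    u3, u4, v0, v1, v2, v3, v4, v5, w0, w193, w311, w312, w368, w500]
  simp only [t0, t193, t311, t312, t368, t500, gVal_500, sub_zero, d,
    show |(193 / 1000 : ℝ)| = 193 / 1000 from d' 193,
    show |(311 / 1000 : ℝ)| = 311 / 1000 from d' 311,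
    show |(312 / 1000 : ℝ)| = 312 / 1000 from d' 312,
    show |(368 / 1000 : ℝ)| = 368 / 1000 from d' 368]
  constructor
  · rintro ⟨⟨a1, a2, a3, a4, a5, a6, a7, a8, a9⟩, ⟨b1, b2, b3, b4, b5⟩⟩
    exact ⟨⟨by linarith only [a1],
      by linarith only [a2], by linarith only [a3], by linarith only [a4],
      by linarith only [a5], by linarith only [a6], by linarith only [a7], by linarith only [a8],
      by linarith only [a9]⟩, by linarith only [b1], by linarith only [b2],
      by linarith only [b3], by linarith only [b4], by linarith only [b5]⟩
  · rintro ⟨⟨a1, a2, a3, a4, a5, a6, a7, a8, a9⟩, ⟨b1, b2, b3, b4, b5⟩⟩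
    exact ⟨⟨by linarith only [a1],
      by linarith only [a2], by linarith only [a3], by linarith only [a4],
      by linarith only [a5], by linarith only [a6], by linarith only [a7], by linarith only [a8],
      by linarith only [a9]⟩, by linarith only [b1], by linarith only [b2],
      by linarith only [b3], by linarith only [b4], by linarith only [b5]⟩

end

noncomputable section

/-! ### Localization of the optimal solutions -/

set_option maxHeartbeats 2000000 in
/-- Near-optimality determines the quantities in the binding constraints up to a small error. -/
lemma core_box {q0 r0 q1 r1 q193 r193 q807 r807 q311 r311 q312 r312 q500 r500 h689 h688 a632
    lam : ℝ}
    (e1 : 2 * r0 ≤ 49927 / 50000)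
    (e2 : q311 / 2 + r311 + 311 / 1000 * q500 + r500 ≤ 49927 / 50000)
    (e3 : q312 / 2 + r312 + 312 / 1000 * q500 + r500 ≤ 49927 / 50000)
    (e4 : 2 * (h689 + q311 * (131633172591466731 / 10 ^ 18)) ≤ 49927 / 50000)
    (e5 : q0 / 2 + r0 + q1 * (171715569847756904 / 10 ^ 18) + r807 ≤ 49927 / 50000)
    (e6 : h688 + q312 * (171715569847756904 / 10 ^ 18) +
      (q807 / 2 + r807 + q193 * (131180739511151822 / 10 ^ 18)) ≤ 49927 / 50000)
    (e7 : q0 / 2 + r0 + q1 * (193147180559945063 / 10 ^ 18) + r1 ≤ 49927 / 50000)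
    (e8 : q193 / 2 + r193 + q807 * (193147180559945063 / 10 ^ 18) +
      (193 / 1000 * q1 + r1) ≤ 49927 / 50000)
    (e9 : a632 + (q1 / 2 + r1 + q0 * (102281295724665614 / 10 ^ 18)) ≤ 49927 / 50000)
    (w1 : 1193 / 1000 * lam ≤ 193 / 1000 * (q0 * (193 / 1000) + r0) +
      807 / 1000 * (q1 / 2 + r1 + q0 * (171715569847757904 / 10 ^ 18)) +
      (q807 / 2 + r807 + q193 * (193147180559946063 / 10 ^ 18)))
    (w2 : 1311 / 1000 * lam ≤ 311 / 1000 * (q0 * (311 / 1000) + r0) +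
      689 / 1000 * (q1 / 2 + r1 + q0 * (131633172591467731 / 10 ^ 18)) +
      (h689 + q311 * (193147180559946063 / 10 ^ 18)))
    (w3 : 1312 / 1000 * lam ≤ 312 / 1000 * (q0 * (312 / 1000) + r0) +
      688 / 1000 * (q1 / 2 + r1 + q0 * (131180739511152822 / 10 ^ 18)) +
      (h688 + q312 * (193147180559946063 / 10 ^ 18)))
    (w4 : 1368 / 1000 * lam ≤ 368 / 1000 * (q0 * (368 / 1000) + r0) +
      632 / 1000 * (q1 / 2 + r1 + q0 * (102281295724666614 / 10 ^ 18)) + a632)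
    (w5 : 1307 / 1000 * lam ≤ 1 / 2 * (q193 / 2 + r193) + 1 / 2 * (q807 / 2 + r807) +
      (193 / 1000 * (q500 * (193 / 1000) + r500) +
      807 / 1000 * (q500 / 2 + r500 + q500 * (171715569847757904 / 10 ^ 18))))
    (p1 : 0 ≤ r1) (p2 : 0 ≤ r311) (p3 : 0 ≤ r312) (p4 : 0 ≤ r500)
    (hl : 835524290631156855 / 10 ^ 18 ≤ lam) :
    |q0 - 760054348654619022 / 10 ^ 18| ≤ 1 / 10 ^ 10 ∧
    |r0 - 499269999999995000 / 10 ^ 18| ≤ 1 / 10 ^ 10 ∧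
    |q1 - 617367674366218318 / 10 ^ 18| ≤ 1 / 10 ^ 10 ∧
    |r1| ≤ 1 / 10 ^ 10 ∧
    |q193 - 1207097259230785313 / 10 ^ 18| ≤ 1 / 10 ^ 10 ∧
    |r193 - 171037939463403179 / 10 ^ 18| ≤ 1 / 10 ^ 10 ∧
    |q807 - 542599014206100533 / 10 ^ 18| ≤ 1 / 10 ^ 10 ∧
    |r807 - 13231183663305795 / 10 ^ 18| ≤ 1 / 10 ^ 10 ∧
    |q311 - 1393173257789632013 / 10 ^ 18| ≤ 1 / 10 ^ 10 ∧
    |r311| ≤ 1 / 10 ^ 10 ∧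
    |q312 - 1391231435467412244 / 10 ^ 18| ≤ 1 / 10 ^ 10 ∧
    |r312| ≤ 1 / 10 ^ 10 ∧
    |q500 - 970911161109884224 / 10 ^ 18| ≤ 1 / 10 ^ 10 ∧
    |r500| ≤ 1 / 10 ^ 10 ∧
    |h689 - 315882184107556262 / 10 ^ 18| ≤ 1 / 10 ^ 10 ∧
    |h688 - 316765299374455131 / 10 ^ 18| ≤ 1 / 10 ^ 10 ∧
    |a632 - 612116819215319292 / 10 ^ 18| ≤ 1 / 10 ^ 10 ∧
    lam ≤ (835524290631156855 + 10 ^ 5) / 10 ^ 18 := by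
  -- Eighteen inequalities in eighteen unknowns: a nonnegative combination of them bounds `lam` from
  -- above. Together with `hl` they confine the unknowns to a tiny region, and each bound is a
  -- linear certificate.
  refine ⟨abs_le.2 ⟨?_, ?_⟩, abs_le.2 ⟨?_, ?_⟩, abs_le.2 ⟨?_, ?_⟩, abs_le.2 ⟨?_, ?_⟩,
    abs_le.2 ⟨?_, ?_⟩, abs_le.2 ⟨?_, ?_⟩, abs_le.2 ⟨?_, ?_⟩, abs_le.2 ⟨?_, ?_⟩,
    abs_le.2 ⟨?_, ?_⟩, abs_le.2 ⟨?_, ?_⟩, abs_le.2 ⟨?_, ?_⟩, abs_le.2 ⟨?_, ?_⟩,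
    abs_le.2 ⟨?_, ?_⟩, abs_le.2 ⟨?_, ?_⟩, abs_le.2 ⟨?_, ?_⟩, abs_le.2 ⟨?_, ?_⟩,
    abs_le.2 ⟨?_, ?_⟩, ?_⟩ <;> linarith

lemma table_core : table 0 = (760054348654619022, 499269999999995000) ∧
    table 193 = (1207097259230785313, 171037939463403179) ∧
    table 311 = (1393173257789632013, 0) ∧
    table 312 = (1391231435467412244, 0) ∧
    table 368 = (1242395987900000000, 17925480000000000) ∧
    table 500 = (970911161109884224, 0) ∧
    table 632 = (684556633400000000, 29873220313446671) ∧
    table 688 = (561014280400000000, 36258159174455131) ∧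
    table 689 = (559381331200000000, 36191518507556262) ∧
    table 807 = (542599014206100533, 13231183663305795) ∧
    table 1000 = (617367674366218318, 0) := by
  decide +kernel

lemma gTab_core :
    gTab 0 = 193147180559945063 ∧ gTab 193 = 171715569847756904 ∧
    gTab 311 = 131633172591466731 ∧ gTab 312 = 131180739511151822 ∧
    gTab 368 = 102281295724665614 := by
  decide +kernel

lemma mul_gVal_mem {x : ℝ} (hx : 0 ≤ x) {j G : ℕ} (hj : j ≤ 500) (hG : gTab j = G) :
    x * ((G : ℝ) / 10 ^ 18) ≤ x * gVal j ∧ x * gVal j ≤ x * (((G + 1000 : ℕ) : ℝ) / 10 ^ 18) := by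
  obtain ⟨h1, h2⟩ := gTab_gVal hj
  rw [hG] at h1 h2
  push_cast
  exact ⟨mul_le_mul_of_nonneg_left (by linarith) hx, mul_le_mul_of_nonneg_left (by linarith) hx⟩

variable {Q R : Fin (1000 + 1) → ℝ}

/-- The values of `f₂` are replaced by rational bounds that weaken each constraint: lower bounds in
feasibility, upper bounds in welfare. The entries at 632, 688, 689 and 368 occur only in three
combinations, which serve as single unknowns. -/
lemma core_box_of_coreFeasible {lam : ℝ} (h0 : ∀ k, 0 ≤ Q k ∧ 0 ≤ R k)
    (hc : CoreFeasible Q R lam) (hl : (lamTab : ℝ) / 10 ^ 18 ≤ lam) :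
    |Q 0 - 760054348654619022 / 10 ^ 18| ≤ 1 / 10 ^ 10 ∧
    |R 0 - 499269999999995000 / 10 ^ 18| ≤ 1 / 10 ^ 10 ∧
    |Q 1000 - 617367674366218318 / 10 ^ 18| ≤ 1 / 10 ^ 10 ∧
    |R 1000| ≤ 1 / 10 ^ 10 ∧
    |Q 193 - 1207097259230785313 / 10 ^ 18| ≤ 1 / 10 ^ 10 ∧
    |R 193 - 171037939463403179 / 10 ^ 18| ≤ 1 / 10 ^ 10 ∧
    |Q 807 - 542599014206100533 / 10 ^ 18| ≤ 1 / 10 ^ 10 ∧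
    |R 807 - 13231183663305795 / 10 ^ 18| ≤ 1 / 10 ^ 10 ∧
    |Q 311 - 1393173257789632013 / 10 ^ 18| ≤ 1 / 10 ^ 10 ∧
    |R 311| ≤ 1 / 10 ^ 10 ∧
    |Q 312 - 1391231435467412244 / 10 ^ 18| ≤ 1 / 10 ^ 10 ∧
    |R 312| ≤ 1 / 10 ^ 10 ∧
    |Q 500 - 970911161109884224 / 10 ^ 18| ≤ 1 / 10 ^ 10 ∧
    |R 500| ≤ 1 / 10 ^ 10 ∧
    |Q 689 / 2 + R 689 - 315882184107556262 / 10 ^ 18| ≤ 1 / 10 ^ 10 ∧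
    |Q 688 / 2 + R 688 - 316765299374455131 / 10 ^ 18| ≤ 1 / 10 ^ 10 ∧
    |Q 632 / 2 + R 632 + Q 368 * gVal 0 - 612116819215319292 / 10 ^ 18| ≤ 1 / 10 ^ 10 ∧
    lam ≤ (lamTab + 10 ^ 5) / 10 ^ 18 := by
  obtain ⟨⟨a1, a2, a3, a4, a5, a6, a7, a8, a9⟩, b1, b2, b3, b4, b5⟩ := (coreFeasible_iff lam).1 hc
  obtain ⟨g0, g193, g311, g312, g368⟩ := gTab_core
  simp only [lamTab] at hl ⊢
  push_cast at hl ⊢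
  have m4 := (mul_gVal_mem (h0 311).1 (by norm_num) g311).1
  have m5 := (mul_gVal_mem (h0 1000).1 (by norm_num) g193).1
  have m6 := (mul_gVal_mem (h0 312).1 (by norm_num) g193).1
  have m6' := (mul_gVal_mem (h0 193).1 (by norm_num) g312).1
  have m7 := (mul_gVal_mem (h0 1000).1 (by norm_num) g0).1
  have m8 := (mul_gVal_mem (h0 807).1 (by norm_num) g0).1
  have m9 := (mul_gVal_mem (h0 0).1 (by norm_num) g368).1
  have n1 := (mul_gVal_mem (h0 0).1 (by norm_num) g193).2
  have n1' := (mul_gVal_mem (h0 193).1 (by norm_num) g0).2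
  have n2 := (mul_gVal_mem (h0 0).1 (by norm_num) g311).2
  have n2' := (mul_gVal_mem (h0 311).1 (by norm_num) g0).2
  have n3 := (mul_gVal_mem (h0 0).1 (by norm_num) g312).2
  have n3' := (mul_gVal_mem (h0 312).1 (by norm_num) g0).2
  have n4 := (mul_gVal_mem (h0 0).1 (by norm_num) g368).2
  have n5 := (mul_gVal_mem (h0 500).1 (by norm_num) g193).2
  push_cast at m4 m5 m6 m6' m7 m8 m9 n1 n1' n2 n2' n3 n3' n4 n5
  refine core_box a1 a2 a3 ?_ ?_ ?_ ?_ ?_ ?_ ?_ ?_ ?_ ?_ ?_ (h0 1000).2 (h0 311).2 (h0 312).2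
    (h0 500).2 hl
  · linarith only [a4, m4]
  · linarith only [a5, m5]
  · linarith only [a6, m6, m6']
  · linarith only [a7, m7]
  · linarith only [a8, m8]
  · linarith only [a9, m9]
  · linarith only [b1, n1, n1']
  · linarith only [b2, n2, n2']
  · linarith only [b3, n3, n3']
  · linarith only [b4, n4]
  · linarith only [b5, n5]

/-- The table satisfies the binding constraints. -/
lemma coreFeasible_table : CoreFeasible (fun k => (qTab k : ℝ) / 10 ^ 18)
    (fun k => (rTab k : ℝ) / 10 ^ 18) ((lamTab : ℝ) / 10 ^ 18) := by
  obtain ⟨t0, t193, t311, t312, t368, t500, t632, t688, t689, t807, t1000⟩ := table_core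
  obtain ⟨g0, g193, g311, g312, g368⟩ := gTab_core
  rw [coreFeasible_iff]
  -- Each constraint is affine in the values `gVal`, known to within `10⁻¹⁵`; the table leaves
  -- enough slack for this uncertainty.
  obtain ⟨c0, c0'⟩ := gTab_gVal (j := 0) (by norm_num)
  obtain ⟨c1, c1'⟩ := gTab_gVal (j := 193) (by norm_num)
  obtain ⟨c2, c2'⟩ := gTab_gVal (j := 311) (by norm_num)
  obtain ⟨c3, c3'⟩ := gTab_gVal (j := 312) (by norm_num)
  obtain ⟨c4, c4'⟩ := gTab_gVal (j := 368) (by norm_num)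
  rw [g0] at c0 c0'
  rw [g193] at c1 c1'
  rw [g311] at c2 c2'
  rw [g312] at c3 c3'
  rw [g368] at c4 c4'
  push_cast at c0 c0' c1 c1' c2 c2' c3 c3' c4 c4'
  have z : ((0 : Fin (1000 + 1)) : ℕ) = 0 := rfl
  have z193 : ((193 : Fin (1000 + 1)) : ℕ) = 193 := rfl
  have z311 : ((311 : Fin (1000 + 1)) : ℕ) = 311 := rfl
  have z312 : ((312 : Fin (1000 + 1)) : ℕ) = 312 := rfl
  have z368 : ((368 : Fin (1000 + 1)) : ℕ) = 368 := rfl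
  have z500 : ((500 : Fin (1000 + 1)) : ℕ) = 500 := rfl
  have z632 : ((632 : Fin (1000 + 1)) : ℕ) = 632 := rfl
  have z688 : ((688 : Fin (1000 + 1)) : ℕ) = 688 := rfl
  have z689 : ((689 : Fin (1000 + 1)) : ℕ) = 689 := rfl
  have z807 : ((807 : Fin (1000 + 1)) : ℕ) = 807 := rfl
  have z1000 : ((1000 : Fin (1000 + 1)) : ℕ) = 1000 := rfl
  simp only [z, z193, z311, z312, z368, z500, z632, z688, z689, z807, z1000, qTab, rTab, t0, t193,
    t311, t312, t368, t500, t632, t688, t689, t807, t1000, lamTab]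
  push_cast
  refine ⟨⟨?_, ?_, ?_, ?_, ?_, ?_, ?_, ?_, ?_⟩, ?_, ?_, ?_, ?_, ?_⟩ <;> linarith

end

noncomputable section

variable {Q R : Fin (1000 + 1) → ℝ}

/-! ### Existence of optimal solutions -/

lemma continuous_alloc {N : ℕ} (t : ℝ) (k : Fin (N + 1)) :
    Continuous fun x : (Fin (N + 1) → ℝ) × (Fin (N + 1) → ℝ) × ℝ => alloc x.1 x.2.1 t k := by
  unfold alloc
  split_ifs <;> fun_prop

lemma isClosed_lpFeasible (N : ℕ) (δ : ℝ) :
    IsClosed {x : (Fin (N + 1) → ℝ) × (Fin (N + 1) → ℝ) × ℝ |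
      LPFeasible N δ x.1 x.2.1 x.2.2} := by
  have e : {x : (Fin (N + 1) → ℝ) × (Fin (N + 1) → ℝ) × ℝ | LPFeasible N δ x.1 x.2.1 x.2.2} =
      {x | (∀ k l, alloc x.1 x.2.1 (gridPt k) l + alloc x.1 x.2.1 (gridPt l) k ≤ 1 - δ) ∧
        (∀ k l, (1 + |gridPt k - gridPt l|) * x.2.2 ≤
          gridUtility x.1 x.2.1 k l + gridUtility x.1 x.2.1 l k) ∧
        ∀ k, 0 ≤ x.1 k ∧ 0 ≤ x.2.1 k} := by
    ext x
    exact ⟨fun h => ⟨h.1, h.2, h.3⟩, fun h => ⟨h.1, h.2.1, h.2.2⟩⟩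
  have hA := continuous_alloc (N := N)
  rw [e]
  simp only [Set.ofPred_and, Set.ofPred_forall, gridUtility]
  refine ((isClosed_iInter fun k => isClosed_iInter fun l => ?_).inter
    ((isClosed_iInter fun k => isClosed_iInter fun l => ?_).inter
      (isClosed_iInter fun k => IsClosed.inter ?_ ?_)))
  · exact isClosed_le ((hA _ _).add (hA _ _)) continuous_const
  · exact isClosed_le (by fun_prop)
      (((continuous_const.mul (hA _ _)).add (continuous_const.mul (hA _ _))).add
        ((continuous_const.mul (hA _ _)).add (continuous_const.mul (hA _ _))))
  · exact isClosed_le continuous_const (by fun_prop)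
  · exact isClosed_le continuous_const (by fun_prop)

/-- Feasibility against the bid `1/2` bounds `Q k / 2 + R k`, and the welfare of two agents of type
`0` is bounded by feasibility at type `1`. These bounds give compactness. -/
lemma LPFeasible.bounds {lam : ℝ} (h : LPFeasible 1000 (2.92 / 2000) Q R lam) :
    (∀ k, Q k ≤ 2) ∧ (∀ k, R k ≤ 2) ∧ lam ≤ 2 := by
  have hQ := fun k => (h.nonneg k).1
  have hR := fun k => (h.nonneg k).2
  have h5 : ∀ k, Q k / 2 + R k ≤ 1 := by
    intro k
    have h1 := h.feasible 500 k
    have h2 := alloc_nonneg hQ hR (gridPt_mem k).1 (gridPt_mem k).2 500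
    rw [alloc_low (i := 500) (by decide)] at h1
    have : (((500 : Fin (1000 + 1)) : ℕ) : ℝ) = 500 := by norm_num
    rw [this] at h1
    linarith
  refine ⟨fun k => by linarith [h5 k, hR k], fun k => by linarith [h5 k, hQ k], ?_⟩
  have h1 := h.competitive 0 0
  have h2 := h.feasible 1000 1000
  have e : (0 : Fin (1000 + 1)).rev = 1000 := by decide
  have z : gridPt (0 : Fin (1000 + 1)) = 0 := by rw [gridPt_eq]; simp
  simp only [gridUtility, e, z, sub_self, abs_zero, zero_mul, sub_zero, add_zero, one_mul,
    zero_add] at h1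
  linarith

/-- Solutions with value at least `lam₀` form a nonempty compact set, on which the value attains its
maximum. -/
lemma exists_lpOptimal {lam₀ : ℝ} (h : LPFeasible 1000 (2.92 / 2000) Q R lam₀) :
    ∃ (Q' R' : Fin (1000 + 1) → ℝ) (lam : ℝ),
      LPOptimal 1000 (2.92 / 2000) Q' R' lam ∧ lam₀ ≤ lam := by
  let K : Set ((Fin (1000 + 1) → ℝ) × (Fin (1000 + 1) → ℝ) × ℝ) :=
    {x | LPFeasible 1000 (2.92 / 2000) x.1 x.2.1 x.2.2} ∩ {x | lam₀ ≤ x.2.2}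
  have hK : IsCompact K := by
    refine IsCompact.of_isClosed_subset (isCompact_Icc (a := ((fun _ => 0, fun _ => 0, lam₀) :
      (Fin (1000 + 1) → ℝ) × (Fin (1000 + 1) → ℝ) × ℝ)) (b := (fun _ => 2, fun _ => 2, 2)))
      ((isClosed_lpFeasible _ _).inter (isClosed_le continuous_const (by fun_prop))) ?_
    rintro ⟨q, r, l⟩ ⟨hx, hl⟩
    obtain ⟨b1, b2, b3⟩ := LPFeasible.bounds hx
    exact ⟨⟨fun k => (hx.nonneg k).1, fun k => (hx.nonneg k).2, hl⟩, ⟨b1, b2, b3⟩⟩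
  obtain ⟨⟨q, r, l⟩, ⟨hx, hl⟩, hmax⟩ := hK.exists_isMaxOn ⟨(Q, R, lam₀), h, le_refl lam₀⟩
    (f := fun x => x.2.2) (by fun_prop)
  refine ⟨q, r, l, ⟨hx, fun q' r' l' h' => ?_⟩, hl⟩
  rcases le_total lam₀ l' with hl' | hl'
  · exact hmax (a := (q', r', l')) ⟨h', hl'⟩
  · exact hl'.trans hl

/-! ### An optimal solution with small slopes -/

/-- The grid points at which the binding constraints determine both coefficients. -/
def coreIdx : List (Fin (1000 + 1)) := [0, 193, 311, 312, 500, 807, 1000]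

/-- The table, with the coefficients at the binding grid points taken from `Q`. -/
def extQ (Q : Fin (1000 + 1) → ℝ) (k : Fin (1000 + 1)) : ℝ :=
  if k ∈ coreIdx then Q k else qTab k / 10 ^ 18

/-- The table, with the coefficients at the binding grid points taken from `R`, and with the values
at `689`, `688` and `632` adjusted so as to preserve the binding constraints. -/
def extR (Q R : Fin (1000 + 1) → ℝ) (k : Fin (1000 + 1)) : ℝ :=
  if k ∈ coreIdx then R k
  else if k = 689 then Q 689 / 2 + R 689 - qTab 689 / 10 ^ 18 / 2
  else if k = 688 then Q 688 / 2 + R 688 - qTab 688 / 10 ^ 18 / 2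
  else if k = 632 then Q 632 / 2 + R 632 + Q 368 * gVal 0 - qTab 632 / 10 ^ 18 / 2 -
    qTab 368 / 10 ^ 18 * gVal 0
  else rTab k / 10 ^ 18

lemma extQ_core {k : Fin (1000 + 1)} (hk : k ∈ coreIdx) : extQ Q k = Q k := if_pos hk

lemma extR_core {k : Fin (1000 + 1)} (hk : k ∈ coreIdx) : extR Q R k = R k := if_pos hk

lemma extQ_table {k : Fin (1000 + 1)} (hk : k ∉ coreIdx) : extQ Q k = qTab k / 10 ^ 18 := if_neg hk

lemma extR_689 : extR Q R 689 = Q 689 / 2 + R 689 - qTab 689 / 10 ^ 18 / 2 := by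
  rw [extR, if_neg (by decide), if_pos rfl]

lemma extR_688 : extR Q R 688 = Q 688 / 2 + R 688 - qTab 688 / 10 ^ 18 / 2 := by
  rw [extR, if_neg (by decide), if_neg (by decide), if_pos rfl]

lemma extR_632 : extR Q R 632 = Q 632 / 2 + R 632 + Q 368 * gVal 0 - qTab 632 / 10 ^ 18 / 2 -
    qTab 368 / 10 ^ 18 * gVal 0 := by
  rw [extR, if_neg (by decide), if_neg (by decide), if_neg (by decide), if_pos rfl]

/-- The binding constraints see the non-core entries only through the three combinations that `extR`
preserves. -/
lemma CoreFeasible.ext {lam : ℝ} (hc : CoreFeasible Q R lam) :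
    CoreFeasible (extQ Q) (extR Q R) lam := by
  rw [coreFeasible_iff] at hc ⊢
  obtain ⟨⟨a1, a2, a3, a4, a5, a6, a7, a8, a9⟩, b1, b2, b3, b4, b5⟩ := hc
  have e689 : extQ Q 689 = qTab 689 / 10 ^ 18 := extQ_table (by decide)
  have e688 : extQ Q 688 = qTab 688 / 10 ^ 18 := extQ_table (by decide)
  have e632 : extQ Q 632 = qTab 632 / 10 ^ 18 := extQ_table (by decide)
  have e368 : extQ Q 368 = qTab 368 / 10 ^ 18 := extQ_table (by decide)
  rw [extQ_core (k := 0) (by decide), extQ_core (k := 193) (by decide),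
    extQ_core (k := 311) (by decide), extQ_core (k := 312) (by decide),
    extQ_core (k := 500) (by decide), extQ_core (k := 807) (by decide),
    extQ_core (k := 1000) (by decide), extR_core (k := 0) (by decide),
    extR_core (k := 193) (by decide), extR_core (k := 311) (by decide),
    extR_core (k := 312) (by decide), extR_core (k := 500) (by decide),
    extR_core (k := 807) (by decide), extR_core (k := 1000) (by decide),
    extR_689, extR_688, extR_632, e689, e688, e632, e368]
  exact ⟨⟨a1, a2, a3, by linarith only [a4], a5, by linarith only [a6], a7, a8,
    by linarith only [a9]⟩, b1, by linarith only [b2], by linarith only [b3],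
    by linarith only [b4], b5⟩

lemma nearTable_ext {lam : ℝ} (h0 : ∀ k, 0 ≤ Q k ∧ 0 ≤ R k)
    (hc : CoreFeasible Q R lam) (hl : (lamTab : ℝ) / 10 ^ 18 ≤ lam) :
    NearTable (extQ Q) (extR Q R) := by
  obtain ⟨b1, b2, b3, b4, b5, b6, b7, b8, b9, b10, b11, b12, b13, b14, b15, b16, b17, -⟩ :=
    core_box_of_coreFeasible h0 hc hl
  obtain ⟨t0, t193, t311, t312, t368, t500, t632, t688, t689, t807, t1000⟩ := table_core
  obtain ⟨g0, -⟩ := gTab_core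
  have small : (1 / 10 ^ 10 : ℝ) ≤ 1 / 10 ^ 9 := by norm_num
  have pair : ∀ {k : Fin (1000 + 1)} {n a b : ℕ} (hk : k ∈ coreIdx), (k : ℕ) = n →
      table n = (a, b) → |Q k - a / 10 ^ 18| ≤ 1 / 10 ^ 10 → |R k - b / 10 ^ 18| ≤ 1 / 10 ^ 10 →
      |extQ Q k - qTab k / 10 ^ 18| ≤ 1 / 10 ^ 9 ∧
        |extR Q R k - rTab k / 10 ^ 18| ≤ 1 / 10 ^ 9 := by
    intro k n a b hk hn ht hq hr
    rw [extQ_core hk, extR_core hk, qTab, rTab, hn, ht]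
    exact ⟨hq.trans small, hr.trans small⟩
  intro k
  by_cases hk : k ∈ coreIdx
  · have hk' := hk
    simp only [coreIdx, List.mem_cons, List.not_mem_nil, or_false] at hk
    rcases hk with rfl | rfl | rfl | rfl | rfl | rfl | rfl
    · exact pair hk' rfl t0 (by exact_mod_cast b1) (by exact_mod_cast b2)
    · exact pair hk' rfl t193 (by exact_mod_cast b5) (by exact_mod_cast b6)
    · exact pair hk' rfl t311 (by exact_mod_cast b9) (by simpa using b10)
    · exact pair hk' rfl t312 (by exact_mod_cast b11) (by simpa using b12)
    · exact pair hk' rfl t500 (by exact_mod_cast b13) (by simpa using b14)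
    · exact pair hk' rfl t807 (by exact_mod_cast b7) (by exact_mod_cast b8)
    · exact pair hk' rfl t1000 (by exact_mod_cast b3) (by simpa using b4)
  · rw [extQ_table hk]
    refine ⟨by rw [sub_self, abs_zero]; norm_num, ?_⟩
    by_cases h689 : k = 689
    · subst h689
      have e : (((689 : Fin (1000 + 1)) : ℕ)) = 689 := rfl
      rw [extR_689, e, qTab, rTab, t689]
      push_cast
      rw [abs_le] at b15 ⊢
      constructor <;> linarith only [b15.1, b15.2]
    by_cases h688 : k = 688
    · subst h688
      have e : (((688 : Fin (1000 + 1)) : ℕ)) = 688 := rfl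
      rw [extR_688, e, qTab, rTab, t688]
      push_cast
      rw [abs_le] at b16 ⊢
      constructor <;> linarith only [b16.1, b16.2]
    by_cases h632 : k = 632
    · subst h632
      have e : (((632 : Fin (1000 + 1)) : ℕ)) = 632 := rfl
      obtain ⟨c1, c2⟩ := gTab_gVal (j := 0) (by norm_num)
      rw [g0] at c1 c2
      push_cast at c1 c2
      rw [extR_632, e, qTab, qTab, rTab, t632, t368]
      push_cast
      rw [abs_le] at b17 ⊢
      constructor <;> linarith only [b17.1, b17.2, c1, c2]
    · rw [extR, if_neg hk, if_neg h689, if_neg h688, if_neg h632, sub_self, abs_zero]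
      norm_num

/-- Only the three adjusted values could become negative; they lie within `10⁻⁹` of table entries
that are at least `10⁻⁸`. -/
lemma ext_nonneg (h0 : ∀ k, 0 ≤ Q k ∧ 0 ≤ R k) (hn : NearTable (extQ Q) (extR Q R))
    (k : Fin (1000 + 1)) : 0 ≤ extQ Q k ∧ 0 ≤ extR Q R k := by
  obtain ⟨-, -, -, -, -, -, t632, t688, t689, -, -⟩ := table_core
  constructor
  · by_cases hk : k ∈ coreIdx
    · rw [extQ_core hk]; exact (h0 k).1
    · rw [extQ_table hk]; positivity
  · by_cases hk : k ∈ coreIdx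
    · rw [extR_core hk]; exact (h0 k).2
    have pos : ∀ {n a b : ℕ}, (k : ℕ) = n → table n = (a, b) → 10 ^ 10 ≤ b → 0 ≤ extR Q R k := by
      intro n a b hkn ht hb
      have h1 := (hn.bounds k).2.2.2
      rw [rTab, hkn, ht] at h1
      have : (10 ^ 10 : ℝ) ≤ b := by exact_mod_cast hb
      dsimp only at h1
      linarith
    by_cases h689 : k = 689
    · exact pos (by rw [h689]; rfl) t689 (by norm_num)
    by_cases h688 : k = 688
    · exact pos (by rw [h688]; rfl) t688 (by norm_num)
    by_cases h632 : k = 632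
    · exact pos (by rw [h632]; rfl) t632 (by norm_num)
    rw [extR, if_neg hk, if_neg h689, if_neg h688, if_neg h632]
    positivity

lemma lpFeasible_table : LPFeasible 1000 (2.92 / 2000) (fun k => (qTab k : ℝ) / 10 ^ 18)
    (fun k => (rTab k : ℝ) / 10 ^ 18) ((lamTab : ℝ) / 10 ^ 18) :=
  lpFeasible_of_coreFeasible (fun k => by simp) (fun k => ⟨by positivity, by positivity⟩)
    (by gcongr; simp) coreFeasible_table

/-- The linear program has an optimal solution with large value and small slopes. -/
theorem exists_lpOptimal_slopes_lt : ∃ (Q R : Fin (1000 + 1) → ℝ) (lam : ℝ),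
    LPOptimal 1000 (2.92 / 2000) Q R lam ∧ 0.835524 < lam ∧ ∀ k, Q k < 1.46 := by
  obtain ⟨Q, R, lam, ⟨hf, hopt⟩, hl⟩ := exists_lpOptimal lpFeasible_table
  have hc := hf.coreFeasible
  have hn := nearTable_ext hf.nonneg hc hl
  have hup := (core_box_of_coreFeasible hf.nonneg hc hl).2.2.2.2.2.2.2.2.2.2.2.2.2.2.2.2.2
  refine ⟨extQ Q, extR Q R, lam, ⟨?_, hopt⟩, ?_, fun k => ?_⟩
  · exact lpFeasible_of_coreFeasible hn (ext_nonneg hf.nonneg hn) hup hc.ext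
  · refine lt_of_lt_of_le ?_ hl
    norm_num [lamTab]
  · have h1 := (hn.bounds k).1
    have h2 : (qTab k : ℝ) ≤ 144 * 10 ^ 16 := by exact_mod_cast qTab_le k.2
    norm_num at h1 ⊢
    linarith

end

end PartialMechanism

open PartialMechanism in
theorem mainTheorem2 :
    (∃ (Q R : Fin (1000 + 1) → ℝ) (lam : ℝ),
      LPOptimal 1000 (2.92 / 2000) Q R lam ∧ 0.835524 < lam ∧ ∀ k, Q k < 1.46) ∧
    (∃ ρ : ℝ → Fin (1000 + 1), IsRounding 1000 ρ) ∧
    (∀ (Q R : Fin (1000 + 1) → ℝ) (lam : ℝ),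
      LPOptimal 1000 (2.92 / 2000) Q R lam → (∀ k, Q k < 1.46) →
      ∀ ρ : ℝ → Fin (1000 + 1), IsRounding 1000 ρ →
        IsSymmetric (roundedMechanism Q R ρ) ∧
        IsFeasible (roundedMechanism Q R ρ) ∧
        IsStrategyproof (roundedMechanism Q R ρ) ∧
        IsCompetitive 0.833689 (roundedMechanism Q R ρ)) ∧
    (5 / 6 + 1 / 10 ^ 9 : ℝ) < 0.833689 := by
  refine ⟨exists_lpOptimal_slopes_lt, exists_isRounding 500 (by norm_num), ?_, by norm_num⟩
  intro Q R lam hopt hQ ρ hρ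
  obtain ⟨Q', R', lam', h', hlam', -⟩ := exists_lpOptimal_slopes_lt
  -- All optimal solutions share the same value, so the bound passes to the given one.
  have hlam : 0.835524 < lam := hlam'.trans_le (hopt.2 _ _ _ h'.1)
  have hN : 0 < 1000 := by norm_num
  refine ⟨ofFun_isSymmetric _, ?_, ?_, ?_⟩
  -- The slope bound `1.46` gives exactly `1.46 / 1000 = δ`.
  · exact roundedMechanism_isFeasible hN hopt.1 (fun k => (hQ k).le) (by norm_num) hρ
  · exact roundedMechanism_isStrategyproof (fun k => (hopt.1.nonneg k).1) hρ
  -- At `lam = 0.835524` the guarantee is `0.835524 - (0.835524 + 0.99854) / 1000 = 0.833689936`,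
  -- and it increases with `lam`.
  · refine roundedMechanism_isCompetitive hN hopt.1 hρ (by norm_num) ?_ ?_
    · norm_num at hlam ⊢; linarith
    · norm_num at hlam ⊢; linarith
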